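/- Let $n\ge 2$, $k\ge 1$ be integers, let $1-\frac2n<m<1$, and for $1\le i\le k$ let $\lambda_i>0$, $\beta_i\ge 0$. Let $0<c<\infty$, $0\le C_1,C_2,C_3,C_4<\infty$, $C_5=0$, $q\in\mathbb R$. Consider on $\mathbb R^n\times(0,\infty)$ the system $$(u^i)_t=\nabla\cdot\big(mU^{m-1}\mathcal A(\nabla u^i,u^i,x,t)+\mathcal B(u^i,x,t)\big),\qquad U=U(u^1,\dots,u^k),\qquad 1\le i\le k,$$ where $\mathcal A(p,z,x,t),\mathcal B(z,x,t)\in\mathbb R^n$ ($p\in\mathbb R^n$, $z\ge0$) are measurable in $(x,t)$ and, for a.e. $(x,t)$, continuous in $(p,z)$, resp. $z$. Assume the following. (a) $U$ is continuous on $[0,\infty)^k$, differentiable in $\xi^i$ at every $\xi\in[0,\infty)^k$ with $\xi^i>0$, and on $[0,\infty)^k$: $U(0)=0$, $\sum_i|U_{\xi^i}(\xi)\,\xi^i|\le C_1U(\xi)$, $U_{\xi^i}(\xi)\ge0$. (Where $\xi^i=0$, $U_{\xi^i}$ is the one-sided derivative, set to $0$ if there is none.) (b) For a.e. $(x,t)$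 and all $p\in\mathbb R^n$, $z\ge0$: $\ \mathcal A(p,z,x,t)\cdot p\ge c|p|^2-C_2z^2$, $\ |\mathcal A(p,z,x,t)|\le C_3|p|+C_4z$, $\ |\mathcal B(z,x,t)|\le C_5z^q$ (that is, $\mathcal B=0$). (c) $u_0^i\ge 0$ is integrable on $\mathbb R^n$ with compact support, for every $i$, and $u=(u^1,\dots,u^k)$ is a weak solution with initial data $u_0=(u_0^1,\dots,u_0^k)$: each $u^i$ is locally integrable on $\mathbb R^n\times[0,\infty)$, with $u^i(\cdot,t)$ locally integrable for every $t>0$; it has a weak spatial gradient $\nabla u^i\in L^2_{loc}(\mathbb R^n\times(0,\infty))$; $U^{m-1}|\mathcal A(\nabla u^i,u^i,x,t)|\in L^2(\mathbb R^n\times(0,T))$ for all $T>0$; and for every $T>0$ and $\varphi\in C_c^\infty(\mathbb R^n\times\mathbb R)$ $$\int_{\mathbb R^n} u^i(x,T)\varphi(x,T)\,dx-\int_{\mathbb R^n} u_0^i(x)\varphi(x,0)\,dx=\int_0^T\!\!\int_{\mathbb R^n}\Big\{u^i\varphi_t-\big(mU^{m-1}\mathcal A(\nabla u^i,u^i,x,t)+\mathcal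 B(u^i,x,t)\big)\cdot\nabla\varphi\Big\}\,dx\,dt .$$ (d) Along the solution, writing $U=U(u^1,\dots,u^k)$ and $U_{u^i}=U_{\xi^i}(u^1,\dots,u^k)$, the functions $U$, $U_{u^i}$, $U^mU_{u^i}$ are locally integrable with locally integrable weak spatial gradients on $\mathbb R^n\times(0,\infty)$, $U^mU_{u^i}\in L^2(0,T;H^1(\mathbb R^n))$ for all $T>0$ and all $i$, and a.e. on $\mathbb R^n\times(0,\infty)$: $\ u^i\ge0$ and $\lambda_i(u^i)^{\beta_i}\le U$ for all $i$, $$\sum_{i=1}^k\big(mU^{m-1}\mathcal A(\nabla u^i,u^i,x,t)+\mathcal B(u^i,x,t)\big)\cdot\nabla U_{u^i}\ge0,\qquad \nabla U\cdot\sum_{i=1}^kU_{u^i}\mathcal A(\nabla u^i,u^i,x,t)\ge c|\nabla U|^2-C_2U^2 .$$ Let $1\le i\le k$ with $\beta_i>0$. If $$m\in\left(1-\frac{4(n+1)}{\beta_i(n^2+5n+8)}+\frac{\sqrt{2n(7n+11)}}{\beta_i(n^2+5n+8)},\,1\right),$$ then for every $t>0$ the function $u^i(\cdot,t)$ is integrable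 and $$\int_{\mathbb R^n}u^i(x,t)\,dx=\int_{\mathbb R^n}u_0^i(x)\,dx .$$ If $C_2=C_4=0$, the same conclusion holds whenever $$m\in\left(1-\frac{3n+1}{\beta_i(n^2+2n+4)}+\frac{\sqrt{7n^2+2n-7}}{\beta_i(n^2+2n+4)},\,1\right).$$ -/

import Mathlib

open MeasureTheory Set
open scoped ContDiff

namespace GPS

/-- Euclidean space of dimension `n`. Points of space-time are pairs `y = (x, t)`. -/
abbrev Space (n : ℕ) := EuclideanSpace ℝ (Fin n)

/-- Space-time for positive times. -/
def domain (n : ℕ) : Set (Space n × ℝ) := univ ×ˢ Ioi 0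

/-- The slab of times in `(0, T]`. -/
def slab (n : ℕ) (T : ℝ) : Set (Space n × ℝ) := univ ×ˢ Ioc 0 T

/-- `G` is the weak spatial gradient of `w` for positive times: both are locally integrable and
`∫ w ∂_v φ = - ∫ (G · v) φ` for every smooth test function `φ` compactly supported in the open
set of positive times and every spatial direction `v`. -/
def IsWeakGradient {n : ℕ} (w : Space n × ℝ → ℝ) (G : Space n × ℝ → Space n) : Prop :=
  LocallyIntegrableOn w (domain n) ∧ LocallyIntegrableOn G (domain n) ∧
    ∀ φ : Space n × ℝ → ℝ, ContDiff ℝ ∞ φ → HasCompactSupport φ → tsupport φ ⊆ domain n →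
      ∀ v : Space n,
        ∫ y in domain n, w y * fderiv ℝ φ y (v, 0) = - ∫ y in domain n, inner ℝ (G y) v * φ y

/-- The partial derivative of `U` in the `i`-th variable, taken inside the set where that variable
is nonnegative (so it is the right derivative where the variable vanishes). -/
noncomputable def pderiv {k : ℕ} (U : (Fin k → ℝ) → ℝ) (i : Fin k) (ξ : Fin k → ℝ) : ℝ :=
  derivWithin (fun s => U (Function.update ξ i s)) (Ici 0) (ξ i)

/-- The vector `(u¹, …, uᵏ)` at the space-time point `y`. -/
def vec {n k : ℕ} (u : Fin k → Space n → ℝ → ℝ) (y : Space n × ℝ) : Fin k → ℝ :=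
  fun i => u i y.1 y.2

/-- The vector `𝒜(∇uⁱ, uⁱ, x, t)` along the solution. -/
def fieldA {n k : ℕ} (A : Space n → ℝ → Space n → ℝ → Space n)
    (u : Fin k → Space n → ℝ → ℝ) (Du : Fin k → Space n × ℝ → Space n)
    (i : Fin k) (y : Space n × ℝ) : Space n :=
  A (Du i y) (u i y.1 y.2) y.1 y.2

/-- The vector `ℬ(uⁱ, x, t)` along the solution. -/
def fieldB {n k : ℕ} (B : ℝ → Space n → ℝ → Space n)
    (u : Fin k → Space n → ℝ → ℝ) (i : Fin k) (y : Space n × ℝ) : Space n :=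
  B (u i y.1 y.2) y.1 y.2

/-- The flux `m U^{m-1} 𝒜(∇uⁱ, uⁱ, x, t) + ℬ(uⁱ, x, t)`. -/
noncomputable def flux {n k : ℕ} (m : ℝ) (U : (Fin k → ℝ) → ℝ)
    (A : Space n → ℝ → Space n → ℝ → Space n) (B : ℝ → Space n → ℝ → Space n)
    (u : Fin k → Space n → ℝ → ℝ) (Du : Fin k → Space n × ℝ → Space n)
    (i : Fin k) (y : Space n × ℝ) : Space n :=
  (m * U (vec u y) ^ (m - 1)) • fieldA A u Du i y + fieldB B u i y

/-- The vector fields are measurable in `(x, t)`, and continuous in the other variables for almost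
every `(x, t)`, on the range `z ≥ 0`. -/
structure Caratheodory {n : ℕ} (A : Space n → ℝ → Space n → ℝ → Space n)
    (B : ℝ → Space n → ℝ → Space n) : Prop where
  measurable_A : ∀ p : Space n, ∀ z : ℝ, 0 ≤ z →
    AEStronglyMeasurable (fun y : Space n × ℝ => A p z y.1 y.2) (volume.restrict (domain n))
  continuous_A : ∀ᵐ y ∂(volume.restrict (domain n)),
    ContinuousOn (fun r : Space n × ℝ => A r.1 r.2 y.1 y.2) {r | 0 ≤ r.2}
  measurable_B : ∀ z : ℝ, 0 ≤ z →
    AEStronglyMeasurable (fun y : Space n × ℝ => B z y.1 y.2) (volume.restrict (domain n))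
  continuous_B : ∀ᵐ y ∂(volume.restrict (domain n)),
    ContinuousOn (fun z : ℝ => B z y.1 y.2) (Ici 0)

/-- Growth and monotonicity of `U` on the orthant of nonnegative vectors. -/
structure CoefficientCondition {k : ℕ} (U : (Fin k → ℝ) → ℝ) (C1 : ℝ) : Prop where
  continuousOn : ContinuousOn U {ξ | ∀ i, 0 ≤ ξ i}
  differentiable : ∀ ξ : Fin k → ℝ, (∀ j, 0 ≤ ξ j) → ∀ i, 0 < ξ i →
    DifferentiableAt ℝ (fun s => U (Function.update ξ i s)) (ξ i)
  zero : U 0 = 0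
  growth : ∀ ξ : Fin k → ℝ, (∀ j, 0 ≤ ξ j) → ∑ i, |pderiv U i ξ * ξ i| ≤ C1 * U ξ
  mono : ∀ ξ : Fin k → ℝ, (∀ j, 0 ≤ ξ j) → ∀ i, 0 ≤ pderiv U i ξ

/-- The structure conditions on the vector fields for all values `p` of the gradient and `z ≥ 0` of
the unknown: coercivity, growth of `𝒜`, growth of `ℬ`. -/
structure FieldCondition {n : ℕ} (A : Space n → ℝ → Space n → ℝ → Space n)
    (B : ℝ → Space n → ℝ → Space n) (c C2 C3 C4 C5 q : ℝ) : Prop where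
  coercive : ∀ᵐ y ∂(volume.restrict (domain n)), ∀ p : Space n, ∀ z : ℝ, 0 ≤ z →
    c * ‖p‖ ^ 2 - C2 * z ^ 2 ≤ inner ℝ (A p z y.1 y.2) p
  growth_A : ∀ᵐ y ∂(volume.restrict (domain n)), ∀ p : Space n, ∀ z : ℝ, 0 ≤ z →
    ‖A p z y.1 y.2‖ ≤ C3 * ‖p‖ + C4 * z
  growth_B : ∀ᵐ y ∂(volume.restrict (domain n)), ∀ z : ℝ, 0 ≤ z →
    ‖B z y.1 y.2‖ ≤ C5 * z ^ q

/-- The conditions that tie `U`, `𝒜` and `ℬ` to the solution `u` with spatial gradients `Du`. -/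
structure SolutionCondition {n k : ℕ} (m : ℝ) (lam β : Fin k → ℝ) (c C2 : ℝ)
    (U : (Fin k → ℝ) → ℝ)
    (A : Space n → ℝ → Space n → ℝ → Space n) (B : ℝ → Space n → ℝ → Space n)
    (u : Fin k → Space n → ℝ → ℝ) (Du : Fin k → Space n × ℝ → Space n) : Prop where
  /-- `uⁱ ≥ 0` and `λᵢ (uⁱ)^{βᵢ} ≤ U`. -/
  lower : ∀ᵐ y ∂(volume.restrict (domain n)), ∀ i,
    0 ≤ u i y.1 y.2 ∧ lam i * u i y.1 y.2 ^ β i ≤ U (vec u y)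
  /-- `U^m U_{uⁱ}` belongs to `L²(0,T; H¹)` for all `T`. -/
  admissible : ∀ i, ∃ G : Space n × ℝ → Space n,
    IsWeakGradient (fun y => U (vec u y) ^ m * pderiv U i (vec u y)) G ∧
    ∀ T : ℝ, 0 < T →
      MemLp (fun y => U (vec u y) ^ m * pderiv U i (vec u y)) 2 (volume.restrict (slab n T)) ∧
      MemLp G 2 (volume.restrict (slab n T))
  /-- `∑ᵢ (m U^{m-1} 𝒜 + ℬ) · ∇U_{uⁱ} ≥ 0`. -/
  monotone_flux : ∃ V : Fin k → Space n × ℝ → Space n,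
    (∀ i, IsWeakGradient (fun y => pderiv U i (vec u y)) (V i)) ∧
    ∀ᵐ y ∂(volume.restrict (domain n)), 0 ≤ ∑ i, inner ℝ (flux m U A B u Du i y) (V i y)
  /-- `∇U · ∑ᵢ U_{uⁱ} 𝒜 ≥ c |∇U|² - C₂ U²`. -/
  coercive_U : ∃ W : Space n × ℝ → Space n,
    IsWeakGradient (fun y => U (vec u y)) W ∧
    ∀ᵐ y ∂(volume.restrict (domain n)),
      c * ‖W y‖ ^ 2 - C2 * U (vec u y) ^ 2 ≤
        inner ℝ (W y) (∑ i, pderiv U i (vec u y) • fieldA A u Du i y)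

/-- `u` is a weak (energy) solution in all of space, for all positive times, of
`(uⁱ)_t = ∇ · (m U^{m-1} 𝒜(∇uⁱ, uⁱ, x, t) + ℬ(uⁱ, x, t))` with initial data `u0`, and `Du i` is
the weak spatial gradient of `uⁱ`. -/
structure IsWeakSolution {n k : ℕ} (m : ℝ) (U : (Fin k → ℝ) → ℝ)
    (A : Space n → ℝ → Space n → ℝ → Space n) (B : ℝ → Space n → ℝ → Space n)
    (u0 : Fin k → Space n → ℝ)
    (u : Fin k → Space n → ℝ → ℝ) (Du : Fin k → Space n × ℝ → Space n) : Prop where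
  locallyIntegrable : ∀ i,
    LocallyIntegrableOn (fun y : Space n × ℝ => u i y.1 y.2) (univ ×ˢ Ici 0)
  locallyIntegrable_slice : ∀ i, ∀ t : ℝ, 0 < t → LocallyIntegrable (fun x => u i x t)
  weakGradient : ∀ i, IsWeakGradient (fun y : Space n × ℝ => u i y.1 y.2) (Du i)
  gradient_sq : ∀ i, ∀ K : Set (Space n × ℝ), IsCompact K → K ⊆ domain n →
    MemLp (Du i) 2 (volume.restrict K)
  energy : ∀ i, ∀ T : ℝ, 0 < T →
    MemLp (fun y => U (vec u y) ^ (m - 1) • fieldA A u Du i y) 2 (volume.restrict (slab n T))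
  locallyIntegrable_B : ∀ i, LocallyIntegrableOn (fieldB B u i) (univ ×ˢ Ici 0)
  /-- The weak form on `(0, T]`, for every `T`. Here `fderiv ℝ φ y (0, 1)` is `φ_t` and
  `fderiv ℝ φ y (F, 0)` is `F · ∇φ` with the spatial gradient. -/
  weak_form : ∀ i, ∀ T : ℝ, 0 < T →
    ∀ φ : Space n × ℝ → ℝ, ContDiff ℝ ∞ φ → HasCompactSupport φ →
      (∫ x, u i x T * φ (x, T)) - ∫ x, u0 i x * φ (x, 0) =
        ∫ y in slab n T,
          (u i y.1 y.2 * fderiv ℝ φ y (0, 1) - fderiv ℝ φ y (flux m U A B u Du i y, 0))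

end GPS

/-! Put `α = β i * (1 - m)`. The bound `λ z^β ≤ U` and the negative exponent `m - 1` give `U^(m-1) ≤
λ^(m-1) z^(-α)`, and `ℬ = 0`, so each component by itself solves a scalar equation `u_t = ∇ · F`
with `|F|² ≤ D S`, where `S = F · ∇u + K u^(2-α) ≥ 0` and `D u^α ≤ K`. This is `ScalarSolution`,
supplied by `scalarSolution_component`. Both ranges of `m` imply `n α < 1`, and under this condition
the flux through spheres at infinity vanishes.

To bound the flux, the equation is tested against `g(u) η² χ` with `g = renorm` bounded and
decreasing (`renormalized_identity`). The weight `w = -g'` behaves like `1 / (u^α (u + κ))`. The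
test bounds `∫ S w η²` by `κ^(-α)` times mass and flux plus `κ^(-2α)` times `∫ (u + κ) η²`
(`lintegral_dissipation_le`). Conversely `|F|² ≤ C (u + κ) S w`, so Young's inequality bounds the
flux across the region where `η` varies by this dissipation and by `∫ (u + κ) |∇η|²`
(`integral_flux_le`). With `κ = R^(-n)` the flux on the right is absorbed, leaving `flux(R) ≤ C
R^(nα-1) (1 + mass(2R))` (`exists_shellFlux_le`).

The mass in a ball is at most the initial mass plus the flux, up to a factor of time
(`localMass_le`). Starting from the crude growth `R^n` given by the square integrability of `F`,
each use of the two inequalities lowers the exponent by `1 - n α > 0`. After finitely many rounds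
the flux is `O(R^(nα-1))`, which tends to zero, and mass is conserved (`mass_eq`). -/

namespace GPS

open Filter Topology Convolution


/-! ### Dominated convergence with varying bounds. -/

/-- Dominated convergence with a convergent sequence of dominating functions. -/
theorem tendsto_integral_of_tendsto_bound {X : Type*} [MeasurableSpace X] {μ : Measure X}
    {J : ℕ → X → ℝ} {J₀ : X → ℝ} {H : ℕ → X → ℝ} {H₀ : X → ℝ}
    (hJm : ∀ j, AEStronglyMeasurable (J j) μ) (hH : ∀ j, Integrable (H j) μ)
    (hH₀ : Integrable H₀ μ) (hle : ∀ j, ∀ᵐ x ∂μ, |J j x| ≤ H j x)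
    (hJ : ∀ᵐ x ∂μ, Tendsto (fun j => J j x) atTop (𝓝 (J₀ x)))
    (hHt : ∀ᵐ x ∂μ, Tendsto (fun j => H j x) atTop (𝓝 (H₀ x)))
    (hI : Tendsto (fun j => ∫ x, H j x ∂μ) atTop (𝓝 (∫ x, H₀ x ∂μ))) :
    Tendsto (fun j => ∫ x, J j x ∂μ) atTop (𝓝 (∫ x, J₀ x ∂μ)) := by
  have hH0 : ∀ j, ∀ᵐ x ∂μ, 0 ≤ H j x := fun j => by
    filter_upwards [hle j] with x hx using (abs_nonneg _).trans hx
  have hH₀0 : ∀ᵐ x ∂μ, 0 ≤ H₀ x := by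
    filter_upwards [hHt, ae_all_iff.2 hH0] with x hx h0 using ge_of_tendsto' hx h0
  -- The part of the bound above the limit has vanishing integral.
  have hneg : Tendsto (fun j => ∫ x, max (H₀ x - H j x) 0 ∂μ) atTop (𝓝 0) := by
    have : Tendsto (fun j => ∫ x, max (H₀ x - H j x) 0 ∂μ) atTop (𝓝 (∫ _, (0:ℝ) ∂μ)) := by
      refine tendsto_integral_of_dominated_convergence H₀
        (fun j => ((hH₀.sub (hH j)).pos_part).aestronglyMeasurable) hH₀ ?_ ?_
      · intro j
        filter_upwards [hH0 j, hH₀0] with x h1 h2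
        rw [Real.norm_of_nonneg (le_max_right _ _)]
        exact max_le (by linarith) h2
      · filter_upwards [hHt] with x hx
        have := (tendsto_const_nhds (x := H₀ x)).sub hx
        simpa using this.max (tendsto_const_nhds (x := (0:ℝ)))
    simpa using this
  -- Positive part equals the function plus its negative part, so convergence of the integrals makes
  -- `H j → H₀` in `L¹`.
  have hpos : Tendsto (fun j => ∫ x, max (H j x - H₀ x) 0 ∂μ) atTop (𝓝 0) := by
    have h1 : ∀ j, ∫ x, max (H j x - H₀ x) 0 ∂μ
        = (∫ x, H j x ∂μ - ∫ x, H₀ x ∂μ) + ∫ x, max (H₀ x - H j x) 0 ∂μ := by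
      intro j
      have i1 : Integrable (fun x => H j x - H₀ x) μ := (hH j).sub hH₀
      have i2 : Integrable (fun x => max (H₀ x - H j x) 0) μ := (hH₀.sub (hH j)).pos_part
      rw [← integral_sub (hH j) hH₀, ← integral_add i1 i2]
      refine integral_congr_ae (Eventually.of_forall fun x => ?_)
      simp only
      rcases le_total (H j x) (H₀ x) with h | h
      · rw [max_eq_right (by linarith), max_eq_left (by linarith)]; ring
      · rw [max_eq_left (by linarith), max_eq_right (by linarith)]; ring
    simp_rw [h1]
    have := (hI.sub (tendsto_const_nhds (x := ∫ x, H₀ x ∂μ))).add hneg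
    simpa using this
  have hJi : ∀ j, Integrable (J j) μ := fun j => (hH j).mono' (hJm j) (hle j)
  -- truncate at the limit bound
  have htr : Tendsto (fun j => ∫ x, max (-H₀ x) (min (J j x) (H₀ x)) ∂μ) atTop
      (𝓝 (∫ x, J₀ x ∂μ)) := by
    refine tendsto_integral_of_dominated_convergence H₀
      (fun j => hH₀.aestronglyMeasurable.neg.sup ((hJm j).inf hH₀.aestronglyMeasurable)) hH₀ ?_ ?_
    · intro j
      filter_upwards [hH₀0] with x h
      rw [Real.norm_eq_abs, abs_le]
      exact ⟨le_max_left _ _, max_le (by linarith) (min_le_right _ _)⟩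
    · filter_upwards [hJ, hHt, ae_all_iff.2 hle] with x h1 h2 h3
      have h4 : |J₀ x| ≤ H₀ x := le_of_tendsto_of_tendsto' h1.abs h2 h3
      have h5 := (tendsto_const_nhds (x := -H₀ x)).max (h1.min (tendsto_const_nhds (x := H₀ x)))
      rwa [min_eq_left (abs_le.1 h4).2, max_eq_right (abs_le.1 h4).1] at h5
  have hmi : ∀ j, Integrable (fun x => max (-H₀ x) (min (J j x) (H₀ x))) μ :=
    fun j => hH₀.neg.sup ((hJi j).inf hH₀)
  -- What the truncation removes is at most the positive part of `H j - H₀`.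
  have hdiff : Tendsto (fun j => ∫ x, J j x ∂μ - ∫ x, max (-H₀ x) (min (J j x) (H₀ x)) ∂μ) atTop
      (𝓝 0) := by
    refine squeeze_zero_norm (fun j => ?_) hpos
    rw [← integral_sub (hJi j) (hmi j)]
    refine norm_integral_le_of_norm_le ((hH j).sub hH₀).pos_part ?_
    filter_upwards [hle j, hH₀0] with x h1 h2
    rw [Real.norm_eq_abs]
    have := abs_le.1 h1
    rcases le_total (J j x) (H₀ x) with h | h
    · rw [min_eq_left h]
      rcases le_total (-H₀ x) (J j x) with h' | h'
      · rw [max_eq_right h']; simp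
      · rw [max_eq_left h', abs_of_nonpos (by linarith)]
        exact le_max_of_le_left (by linarith)
    · rw [min_eq_right h, max_eq_right (by linarith), abs_of_nonneg (by linarith)]
      exact le_max_of_le_left (by linarith)
  simpa using hdiff.add htr

/-! ### Mollification. -/

section Mollify

variable {V : Type*} [NormedAddCommGroup V] [NormedSpace ℝ V] [FiniteDimensional ℝ V]
  [MeasurableSpace V] [BorelSpace V] (μ : Measure V) [μ.IsAddHaarMeasure]

/-- The mollification of a real function by a normalized bump function. -/
noncomputable def mollify (ρ : ContDiffBump (0 : V)) (f : V → ℝ) : V → ℝ :=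
  ρ.normed μ ⋆[ContinuousLinearMap.lsmul ℝ ℝ, μ] f

variable {μ} (ρ : ContDiffBump (0 : V))

theorem mollify_apply (f : V → ℝ) (y : V) :
    mollify μ ρ f y = ∫ z, ρ.normed μ (y - z) * f z ∂μ := by
  simp [mollify, convolution_eq_swap]

theorem contDiff_mollify {f : V → ℝ} (hf : Integrable f μ) : ContDiff ℝ ∞ (mollify μ ρ f) :=
  (ρ.hasCompactSupport_normed (μ := μ)).contDiff_convolution_left _ ρ.contDiff_normed
    hf.locallyIntegrable

theorem integrable_normed_mul {f : V → ℝ} (hf : Integrable f μ) (y : V) :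
    Integrable (fun z => ρ.normed μ (y - z) * f z) μ := by
  obtain ⟨C, hC⟩ := ρ.hasCompactSupport_normed.exists_bound_of_continuous
    (ρ.continuous_normed (μ := μ))
  exact hf.bdd_mul (c := C) ((ρ.continuous_normed.comp
    (continuous_const.sub continuous_id)).aestronglyMeasurable)
    (Eventually.of_forall fun z => hC _)

theorem fderiv_mollify {f : V → ℝ} (hf : Integrable f μ) (y v : V) :
    fderiv ℝ (mollify μ ρ f) y v = ∫ z, fderiv ℝ (ρ.normed μ) (y - z) v * f z ∂μ := by
  have h := (ρ.hasCompactSupport_normed (μ := μ)).hasFDerivAt_convolution_left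
    (ContinuousLinearMap.lsmul ℝ ℝ) (μ := μ) (g := f) (𝕜 := ℝ)
    (ρ.contDiff_normed (n := 1) (μ := μ)) hf.locallyIntegrable y
  rw [show fderiv ℝ (mollify μ ρ f) y = _ from h.fderiv, convolution_eq_swap,
    ContinuousLinearMap.integral_apply]
  · simp
  · have h2 := (ρ.hasCompactSupport_normed (μ := μ)).fderiv (𝕜 := ℝ)
    have h3 := h2.convolutionExists_left (ContinuousLinearMap.precompL V
      (ContinuousLinearMap.lsmul ℝ ℝ)) (μ := μ)
      ((ρ.contDiff_normed (n := 1)).continuous_fderiv (by simp)) hf.locallyIntegrable y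
    exact h3.integrable_swap

theorem integral_normed_sub (y : V) : ∫ z, ρ.normed μ (y - z) ∂μ = 1 := by
  rw [integral_sub_left_eq_self (fun z => ρ.normed μ z) μ y, ρ.integral_normed]

theorem mollify_nonneg {f : V → ℝ} (h : 0 ≤ᵐ[μ] f) (y : V) : 0 ≤ mollify μ ρ f y := by
  rw [mollify_apply]
  refine integral_nonneg_of_ae ?_
  filter_upwards [h] with z hz using mul_nonneg (ρ.nonneg_normed _) hz

/-- Jensen's inequality: the kernel is a probability density with mean `a`, and the variance of `f`
about `a` is nonnegative. -/
theorem sq_mollify_le {f : V → ℝ} (hf : Integrable f μ) (hf2 : Integrable (fun z => f z ^ 2) μ)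
    (y : V) : mollify μ ρ f y ^ 2 ≤ mollify μ ρ (fun z => f z ^ 2) y := by
  set a := mollify μ ρ f y with ha
  have h1 : Integrable (fun z => ρ.normed μ (y - z)) μ :=
    (ρ.integrable_normed (μ := μ)).comp_sub_left y
  have h : 0 ≤ ∫ z, ρ.normed μ (y - z) * (f z - a) ^ 2 ∂μ :=
    integral_nonneg fun z => mul_nonneg (ρ.nonneg_normed _) (sq_nonneg _)
  have e : ∀ z, ρ.normed μ (y - z) * (f z - a) ^ 2 = ρ.normed μ (y - z) * f z ^ 2
      - 2 * a * (ρ.normed μ (y - z) * f z) + a ^ 2 * ρ.normed μ (y - z) := fun z => by ring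
  have i1 : Integrable (fun z => ρ.normed μ (y - z) * f z ^ 2
      - 2 * a * (ρ.normed μ (y - z) * f z)) μ :=
    (integrable_normed_mul ρ hf2 y).sub ((integrable_normed_mul ρ hf y).const_mul _)
  simp_rw [e] at h
  rw [integral_add i1 (h1.const_mul _), integral_sub (integrable_normed_mul ρ hf2 y) ((integrable_normed_mul ρ hf y).const_mul _),
    integral_const_mul, integral_const_mul, integral_normed_sub, ← mollify_apply,
    ← mollify_apply, ← ha] at h
  linarith [h, sq_nonneg a]

theorem integrable_mollify {f : V → ℝ} (hf : Integrable f μ) : Integrable (mollify μ ρ f) μ :=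
  (ρ.integrable_normed (μ := μ)).integrable_convolution _ hf

theorem integral_mollify {f : V → ℝ} (hf : Integrable f μ) :
    ∫ y, mollify μ ρ f y ∂μ = ∫ y, f y ∂μ := by
  have := integral_convolution (ContinuousLinearMap.lsmul ℝ ℝ) (μ := μ) (ν := μ)
    (ρ.integrable_normed (μ := μ)) hf
  simpa [mollify, ρ.integral_normed] using this

theorem ae_tendsto_mollify {ρ : ℕ → ContDiffBump (0 : V)}
    (h0 : Tendsto (fun j => (ρ j).rOut) atTop (𝓝 0))
    (h2 : ∀ j, (ρ j).rOut ≤ 2 * (ρ j).rIn) {f : V → ℝ} (hf : LocallyIntegrable f μ) :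
    ∀ᵐ y ∂μ, Tendsto (fun j => mollify μ (ρ j) f y) atTop (𝓝 (f y)) :=
  ContDiffBump.ae_convolution_tendsto_right_of_locallyIntegrable h0 (Eventually.of_forall h2) hf

end Mollify


set_option linter.unusedSectionVars false

/-! ### The renormalized equation. -/

section Renormalized

variable {V : Type*} [NormedAddCommGroup V] [NormedSpace ℝ V] [FiniteDimensional ℝ V]
  [MeasurableSpace V] [BorelSpace V] {μ : Measure V} [μ.IsAddHaarMeasure]

/-- Control of `h` at nonnegative arguments suffices, because mollifying a nonnegative function
keeps it nonnegative. -/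
theorem hasFDerivAt_comp_nonneg {h h' : ℝ → ℝ} (hh : ∀ s, 0 ≤ s → HasDerivAt h (h' s) s)
    {v : V → ℝ} (hv : ContDiff ℝ 1 v) (hv0 : ∀ y, 0 ≤ v y) (y : V) :
    HasFDerivAt (fun y => h (v y)) (h' (v y) • fderiv ℝ v y) y :=
  (hh _ (hv0 y)).comp_hasFDerivAt y ((hv.differentiable (by simp)) y).hasFDerivAt

theorem contDiff_comp_nonneg {h h' : ℝ → ℝ} (hh : ∀ s, 0 ≤ s → HasDerivAt h (h' s) s)
    (hc : ContinuousOn h' (Ici 0)) {v : V → ℝ} (hv : ContDiff ℝ 1 v) (hv0 : ∀ y, 0 ≤ v y) :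
    ContDiff ℝ 1 (fun y => h (v y)) := by
  refine contDiff_one_iff_fderiv.2
    ⟨fun y => (hasFDerivAt_comp_nonneg hh hv hv0 y).differentiableAt, ?_⟩
  rw [show fderiv ℝ (fun y => h (v y)) = fun y => h' (v y) • fderiv ℝ v y from
    funext fun y => (hasFDerivAt_comp_nonneg hh hv hv0 y).fderiv]
  exact (hc.comp_continuous hv.continuous hv0).smul (hv.continuous_fderiv (by simp))

theorem integral_mul_fderiv_of_hasCompactSupport {P ψ : V → ℝ} (hP : ContDiff ℝ 1 P)
    (hψ : ContDiff ℝ 1 ψ) (hc : HasCompactSupport ψ) (v : V) :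
    ∫ y, P y * fderiv ℝ ψ y v ∂μ = -∫ y, fderiv ℝ P y v * ψ y ∂μ := by
  have hψ' : Continuous fun y => fderiv ℝ ψ y v :=
    (hψ.continuous_fderiv (by simp)).clm_apply continuous_const
  have hP' : Continuous fun y => fderiv ℝ P y v :=
    (hP.continuous_fderiv (by simp)).clm_apply continuous_const
  refine integral_mul_fderiv_eq_neg_fderiv_mul_of_integrable ?_ ?_ ?_
    (fun x _ => (hP.differentiable (by simp)) x) (fun x _ => (hψ.differentiable (by simp)) x)
  · exact (hP'.mul hψ.continuous).integrable_of_hasCompactSupport hc.mul_left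
  · exact (hP.continuous.mul hψ').integrable_of_hasCompactSupport (hc.fderiv_apply (𝕜 := ℝ) v).mul_left
  · exact (hP.continuous.mul hψ.continuous).integrable_of_hasCompactSupport hc.mul_left

theorem integral_mul_indicator_eq {Ω N : Set V} (hΩ : MeasurableSet Ω) (hN : MeasurableSet N)
    (hNΩ : N ⊆ Ω) (f : V → ℝ) {ψ : V → ℝ} (hψ : ∀ z, z ∉ N → ψ z = 0) :
    ∫ z, ψ z * N.indicator f z ∂μ = ∫ z in Ω, f z * ψ z ∂μ := by
  have h1 : ∀ z, ψ z * N.indicator f z = N.indicator (fun z => f z * ψ z) z := fun z => by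
    by_cases hz : z ∈ N
    · simp [hz, mul_comm]
    · simp [hz]
  have h2 : ∫ z in Ω, f z * ψ z ∂μ = ∫ z in N, f z * ψ z ∂μ :=
    setIntegral_eq_of_subset_of_forall_sdiff_eq_zero hΩ hNΩ
      (fun z hz => by simp [hψ z hz.2])
  simp_rw [h1]
  rw [integral_indicator hN, h2]

/-- The identities satisfied by the mollification of a solution at the points whose neighbourhood
lies in the truncation set. -/
theorem fderiv_mollify_of_weak {Ω N : Set V} (hΩ : MeasurableSet Ω)
    (hN : MeasurableSet N) (hNΩ : N ⊆ Ω)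
    {ι : Type*} [Fintype ι] (e : ι → V) (τ : V) {u : V → ℝ} {F D : ι → V → ℝ}
    (hu : IntegrableOn u N μ) (hF : ∀ a, IntegrableOn (F a) N μ)
    (hgrad : ∀ φ : V → ℝ, ContDiff ℝ ∞ φ → HasCompactSupport φ → tsupport φ ⊆ Ω → ∀ a,
      ∫ y in Ω, u y * fderiv ℝ φ y (e a) ∂μ = -∫ y in Ω, D a y * φ y ∂μ)
    (hweak : ∀ φ : V → ℝ, ContDiff ℝ ∞ φ → HasCompactSupport φ → tsupport φ ⊆ Ω →
      ∫ y in Ω, u y * fderiv ℝ φ y τ ∂μ = ∫ y in Ω, ∑ a, F a y * fderiv ℝ φ y (e a) ∂μ)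
    (ρ : ContDiffBump (0 : V)) {y : V} (hy : Metric.closedBall y ρ.rOut ⊆ N) :
    (∀ a, fderiv ℝ (mollify μ ρ (N.indicator u)) y (e a) = mollify μ ρ (N.indicator (D a)) y) ∧
    fderiv ℝ (mollify μ ρ (N.indicator u)) y τ
      = ∑ a, fderiv ℝ (mollify μ ρ (N.indicator (F a))) y (e a) := by
  -- The kernel centred at `y` is itself an admissible test function; differentiating the
  -- mollification in `y` is minus differentiating `ψ` in `z`.
  set ψ : V → ℝ := fun z => ρ.normed μ (y - z) with hψdef
  have hψs : ContDiff ℝ ∞ ψ := ρ.contDiff_normed.comp (contDiff_const.sub contDiff_id)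
  have hsub : tsupport ψ ⊆ Metric.closedBall y ρ.rOut := by
    refine closure_minimal (fun z hz => ?_) Metric.isClosed_closedBall
    have : y - z ∈ Function.support (ρ.normed μ) := hz
    rw [ρ.support_normed_eq, mem_ball_zero_iff] at this
    rw [Metric.mem_closedBall, dist_comm, dist_eq_norm]
    exact this.le
  have hψc : HasCompactSupport ψ :=
    HasCompactSupport.of_support_subset_isCompact (isCompact_closedBall y ρ.rOut)
      ((subset_tsupport _).trans hsub)
  have hψΩ : tsupport ψ ⊆ Ω := (hsub.trans hy).trans hNΩ
  have hψ' : ∀ z v, fderiv ℝ ψ z v = -fderiv ℝ (ρ.normed μ) (y - z) v := fun z v => by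
    have h1 : HasFDerivAt (ρ.normed μ) (fderiv ℝ (ρ.normed μ) (y - z)) (y - z) :=
      (ρ.contDiff_normed.differentiable (n := 1) (by simp) _).hasFDerivAt
    have h2 := h1.comp z ((hasFDerivAt_const y z).sub (hasFDerivAt_id z))
    rw [show fderiv ℝ ψ z = _ from h2.fderiv]
    simp
  have hz0 : ∀ z, z ∉ N → ψ z = 0 := fun z hz =>
    image_eq_zero_of_notMem_tsupport fun h => hz (hy (hsub h))
  have hz1 : ∀ v z, z ∉ N → fderiv ℝ ψ z v = 0 := fun v z hz => by
    rw [fderiv_of_notMem_tsupport (𝕜 := ℝ) (fun h => hz (hy (hsub h)))]; rfl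
  have hd : ∀ f : V → ℝ, IntegrableOn f N μ → ∀ v, fderiv ℝ (mollify μ ρ (N.indicator f)) y v
      = -∫ z in Ω, f z * fderiv ℝ ψ z v ∂μ := fun f hf v => by
    rw [fderiv_mollify ρ (hf.integrable_indicator hN),
      ← integral_mul_indicator_eq hΩ hN hNΩ f (hz1 v), ← integral_neg]
    simp_rw [hψ', neg_mul, neg_neg]
  refine ⟨fun a => ?_, ?_⟩
  · rw [hd u hu, hgrad ψ hψs hψc hψΩ, neg_neg, mollify_apply,
      integral_mul_indicator_eq hΩ hN hNΩ (D a) hz0]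
  · rw [hd u hu, hweak ψ hψs hψc hψΩ]
    simp_rw [hd _ (hF _)]
    rw [Finset.sum_neg_distrib, integral_finsetSum]
    intro a _
    have : IntegrableOn (fun z => F a z * fderiv ℝ ψ z (e a)) N μ := by
      obtain ⟨C, hC⟩ := (hψc.fderiv_apply (𝕜 := ℝ) (e a)).exists_bound_of_continuous
        ((hψs.continuous_fderiv (by simp)).clm_apply continuous_const)
      exact (hF a).mul_bdd (c := C) ((hψs.continuous_fderiv (by simp)).clm_apply
        continuous_const).aestronglyMeasurable (Eventually.of_forall fun z => hC z)
    exact this.of_forall_sdiff_eq_zero hΩ fun z hz => by simp [hz1 (e a) z hz.2]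

/-- The renormalized equation: a weak solution of `∂_τ u = ∑ ∂_a F_a` with square integrable flux and
gradient may be tested against `g(u) φ`. -/
theorem renormalized_identity {Ω : Set V} (hΩ : IsOpen Ω) {ι : Type*} [Fintype ι]
    (e : ι → V) (τ : V) {u : V → ℝ} {F D : ι → V → ℝ}
    (hu : ∀ K, IsCompact K → K ⊆ Ω → IntegrableOn u K μ)
    (hF : ∀ a K, IsCompact K → K ⊆ Ω → MemLp (F a) 2 (μ.restrict K))
    (hD : ∀ a K, IsCompact K → K ⊆ Ω → MemLp (D a) 2 (μ.restrict K))
    (hu0 : ∀ᵐ y ∂μ.restrict Ω, 0 ≤ u y)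
    (hgrad : ∀ φ : V → ℝ, ContDiff ℝ ∞ φ → HasCompactSupport φ → tsupport φ ⊆ Ω → ∀ a,
      ∫ y in Ω, u y * fderiv ℝ φ y (e a) ∂μ = -∫ y in Ω, D a y * φ y ∂μ)
    (hweak : ∀ φ : V → ℝ, ContDiff ℝ ∞ φ → HasCompactSupport φ → tsupport φ ⊆ Ω →
      ∫ y in Ω, u y * fderiv ℝ φ y τ ∂μ = ∫ y in Ω, ∑ a, F a y * fderiv ℝ φ y (e a) ∂μ)
    {G g g' : ℝ → ℝ} {C : ℝ} (hG : ∀ s, 0 ≤ s → HasDerivAt G (g s) s)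
    (hg : ∀ s, 0 ≤ s → HasDerivAt g (g' s) s) (hg'c : ContinuousOn g' (Ici 0))
    (hGb : ∀ s, 0 ≤ s → |G s| ≤ C * s) (hgb : ∀ s, 0 ≤ s → |g s| ≤ C)
    (hgb' : ∀ s, 0 ≤ s → |g' s| ≤ C)
    {φ : V → ℝ} (hφ : ContDiff ℝ ∞ φ) (hφc : HasCompactSupport φ) (hφΩ : tsupport φ ⊆ Ω) :
    Integrable (fun y => G (u y) * fderiv ℝ φ y τ
      - ∑ a, F a y * (g' (u y) * D a y * φ y + g (u y) * fderiv ℝ φ y (e a))) μ ∧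
    ∫ y, (G (u y) * fderiv ℝ φ y τ
      - ∑ a, F a y * (g' (u y) * D a y * φ y + g (u y) * fderiv ℝ φ y (e a))) ∂μ = 0 := by
  have hC : 0 ≤ C := (abs_nonneg _).trans (hgb 0 le_rfl)
  -- The collar of width `r` contains every mollification ball centred in the support of `φ`, so
  -- truncation to `N` is invisible there.
  obtain ⟨r, hr, hrΩ⟩ := hφc.isCompact.exists_cthickening_subset_open hΩ hφΩ
  set N := Metric.cthickening r (tsupport φ) with hNdef
  have hNc : IsCompact N := hφc.isCompact.cthickening
  have hN : MeasurableSet N := hNc.measurableSet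
  have hφN : tsupport φ ⊆ N := Metric.self_subset_cthickening _
  have : IsFiniteMeasure (μ.restrict N) := ⟨by simpa using hNc.measure_lt_top⟩
  have hgc : ContinuousOn g (Ici 0) := fun s hs => (hg s hs).continuousAt.continuousWithinAt
  -- truncated functions
  have iu : Integrable (N.indicator u) μ := (hu N hNc hrΩ).integrable_indicator hN
  have iF : ∀ a, Integrable (N.indicator (F a)) μ := fun a =>
    IntegrableOn.integrable_indicator ((hF a N hNc hrΩ).integrable (by norm_num)) hN
  have iD : ∀ a, Integrable (N.indicator (D a)) μ := fun a =>
    IntegrableOn.integrable_indicator ((hD a N hNc hrΩ).integrable (by norm_num)) hN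
  have sq : ∀ f : V → ℝ, MemLp f 2 (μ.restrict N) →
      Integrable (fun z => N.indicator f z ^ 2) μ := fun f hf => by
    have h1 : IntegrableOn (fun z => f z ^ 2) N μ := hf.integrable_sq
    refine (h1.integrable_indicator hN).congr (Eventually.of_forall fun z => ?_)
    by_cases hz : z ∈ N <;> simp [hz]
  have iF2 := fun a => sq _ (hF a N hNc hrΩ)
  have iD2 := fun a => sq _ (hD a N hNc hrΩ)
  have hu0' : 0 ≤ᵐ[μ] N.indicator u := by
    have := (ae_restrict_iff' hΩ.measurableSet).1 hu0
    filter_upwards [this] with z hz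
    by_cases hzN : z ∈ N
    · simpa [hzN] using hz (hrΩ hzN)
    · simp [hzN]
  -- the mollifiers
  let ρ : ℕ → ContDiffBump (0 : V) := fun j =>
    ⟨r / (j + 1) / 2, r / (j + 1), by positivity, half_lt_self (by positivity)⟩
  have hρ0 : Tendsto (fun j => (ρ j).rOut) atTop (𝓝 0) := by
    have := (tendsto_one_div_add_atTop_nhds_zero_nat (𝕜 := ℝ)).const_mul r
    simpa [ρ, div_eq_mul_inv] using this
  have hρ2 : ∀ j, (ρ j).rOut ≤ 2 * (ρ j).rIn := fun j => by
    change r / (j + 1) ≤ 2 * (r / (j + 1) / 2); linarith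
  have hρr : ∀ j, (ρ j).rOut ≤ r := fun j =>
    div_le_self hr.le (by linarith [Nat.cast_nonneg (α := ℝ) j])
  have hball : ∀ j, ∀ y ∈ tsupport φ, Metric.closedBall y (ρ j).rOut ⊆ N := fun j y hy =>
    (Metric.closedBall_subset_closedBall (hρr j)).trans
      (Metric.closedBall_subset_cthickening hy r)
  -- bounds for the test function
  have hφd : ∀ v, Continuous fun y => fderiv ℝ φ y v := fun v =>
    (hφ.continuous_fderiv (by simp)).clm_apply continuous_const
  obtain ⟨B₀, hB₀⟩ := hφc.exists_bound_of_continuous hφ.continuous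
  obtain ⟨B₁, hB₁⟩ := (hφc.fderiv_apply (𝕜 := ℝ) τ).exists_bound_of_continuous (hφd τ)
  choose B₂ hB₂ using fun a =>
    (hφc.fderiv_apply (𝕜 := ℝ) (e a)).exists_bound_of_continuous (hφd (e a))
  have hB₀0 : 0 ≤ B₀ := (norm_nonneg _).trans (hB₀ 0)
  have hB₁0 : 0 ≤ B₁ := (norm_nonneg _).trans (hB₁ 0)
  have hB₂0 : ∀ a, 0 ≤ B₂ a := fun a => (norm_nonneg _).trans (hB₂ a 0)
  -- mollified functions
  set U : ℕ → V → ℝ := fun j => mollify μ (ρ j) (N.indicator u) with hU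
  set Fm : ℕ → ι → V → ℝ := fun j a => mollify μ (ρ j) (N.indicator (F a)) with hFm
  set Dm : ℕ → ι → V → ℝ := fun j a => mollify μ (ρ j) (N.indicator (D a)) with hDm
  have hU0 : ∀ j y, 0 ≤ U j y := fun j y => mollify_nonneg _ hu0' y
  have hUc : ∀ j, ContDiff ℝ 1 (U j) := fun j => (contDiff_mollify _ iu).of_le (by simp)
  have hFc : ∀ j a, ContDiff ℝ 1 (Fm j a) := fun j a => (contDiff_mollify _ (iF a)).of_le (by simp)
  have hDc : ∀ j a, Continuous (Dm j a) := fun j a => (contDiff_mollify _ (iD a)).continuous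
  have hφ1 : ContDiff ℝ 1 φ := hφ.of_le (by simp)
  have hGU : ∀ j, ContDiff ℝ 1 fun y => G (U j y) := fun j =>
    contDiff_comp_nonneg hG hgc (hUc j) (hU0 j)
  have hgU : ∀ j, ContDiff ℝ 1 fun y => g (U j y) := fun j =>
    contDiff_comp_nonneg hg hg'c (hUc j) (hU0 j)
  have hg'U : ∀ j, Continuous fun y => g' (U j y) := fun j =>
    hg'c.comp_continuous (hUc j).continuous (hU0 j)
  have hψ1 : ∀ j, ContDiff ℝ 1 fun y => g (U j y) * φ y := fun j => (hgU j).mul hφ1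
  have hψc : ∀ j, HasCompactSupport fun y => g (U j y) * φ y := fun j => hφc.mul_left
  set J : ℕ → V → ℝ := fun j y => G (U j y) * fderiv ℝ φ y τ
      - ∑ a, Fm j a y * (g' (U j y) * Dm j a y * φ y + g (U j y) * fderiv ℝ φ y (e a)) with hJ
  have hout : ∀ y, y ∉ tsupport φ → φ y = 0 ∧ ∀ v, fderiv ℝ φ y v = 0 := fun y hy =>
    ⟨image_eq_zero_of_notMem_tsupport hy, fun v => by
      rw [fderiv_of_notMem_tsupport (𝕜 := ℝ) hy]; rfl⟩
  have hloc := fun j y (hy : y ∈ tsupport φ) =>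
    fderiv_mollify_of_weak hΩ.measurableSet hN hrΩ e τ (hu N hNc hrΩ)
      (fun a => ((hF a N hNc hrΩ).integrable (by norm_num))) hgrad hweak (ρ j) (hball j y hy)
  -- each smooth identity
  have hJ0 : ∀ j, ∫ y, J j y ∂μ = 0 := fun j => by
    -- Integrating by parts along `τ` and along each `e a` leaves the mollified equation multiplied
    -- by `g (U j) φ`. The equation is needed only on the support of `φ`, where it holds.
    have e1 := integral_mul_fderiv_of_hasCompactSupport (μ := μ) (hGU j) hφ1 hφc τ
    have e2 := fun a => integral_mul_fderiv_of_hasCompactSupport (μ := μ) (hFc j a) (hψ1 j)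
      (hψc j) (e a)
    have e3 : ∀ a y, Fm j a y * fderiv ℝ (fun y => g (U j y) * φ y) y (e a)
        = Fm j a y * (g' (U j y) * Dm j a y * φ y + g (U j y) * fderiv ℝ φ y (e a)) := by
      intro a y
      have h1 := (hasFDerivAt_comp_nonneg hg (hUc j) (hU0 j) y).mul
        (hφ1.differentiable (by simp) y).hasFDerivAt
      rw [show fderiv ℝ (fun y => g (U j y) * φ y) y = _ from h1.fderiv]
      by_cases hy : y ∈ tsupport φ
      · simp only [add_apply, smul_apply, smul_eq_mul]
        rw [(hloc j y hy).1 a]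
        ring
      · simp [(hout y hy).1, (hout y hy).2]
    have e4 : ∀ y, fderiv ℝ (fun y => G (U j y)) y τ * φ y
        = ∑ a, fderiv ℝ (Fm j a) y (e a) * (g (U j y) * φ y) := by
      intro y
      rw [(hasFDerivAt_comp_nonneg hG (hUc j) (hU0 j) y).fderiv]
      by_cases hy : y ∈ tsupport φ
      · simp only [smul_apply, smul_eq_mul]
        rw [(hloc j y hy).2, Finset.mul_sum, Finset.sum_mul]
        exact Finset.sum_congr rfl fun a _ => by ring
      · simp [(hout y hy).1]
    have c1 : Integrable (fun y => G (U j y) * fderiv ℝ φ y τ) μ :=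
      ((hGU j).continuous.mul (hφd τ)).integrable_of_hasCompactSupport
        (hφc.fderiv_apply (𝕜 := ℝ) τ).mul_left
    have c2 : ∀ a, Integrable (fun y => fderiv ℝ (Fm j a) y (e a) * (g (U j y) * φ y)) μ := fun a =>
      ((((hFc j a).continuous_fderiv (by simp)).clm_apply continuous_const).mul
        (hψ1 j).continuous).integrable_of_hasCompactSupport (hψc j).mul_left
    have c3 : ∀ a, Integrable (fun y => Fm j a y * fderiv ℝ (fun y => g (U j y) * φ y) y (e a)) μ :=
      fun a => ((hFc j a).continuous.mul (((hψ1 j).continuous_fderiv (by simp)).clm_apply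
        continuous_const)).integrable_of_hasCompactSupport
          ((hψc j).fderiv_apply (𝕜 := ℝ) (e a)).mul_left
    have : J j = fun y => G (U j y) * fderiv ℝ φ y τ
        - ∑ a, Fm j a y * fderiv ℝ (fun y => g (U j y) * φ y) y (e a) := by
      funext y
      simp only [hJ, e3]
    rw [this, integral_sub c1 (integrable_finsetSum _ fun a _ => c3 a), e1,
      integral_finsetSum _ fun a _ => c3 a]
    simp_rw [e4, e2]
    rw [integral_finsetSum _ fun a _ => c2 a, Finset.sum_neg_distrib]
    ring
  have hJc : ∀ j, Continuous (J j) := fun j =>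
    ((hGU j).continuous.mul (hφd τ)).sub (continuous_finsetSum _ fun a _ =>
      (hFc j a).continuous.mul ((((hg'U j).mul (hDc j a)).mul hφ.continuous).add
        ((hgU j).continuous.mul (hφd (e a)))))
  -- the dominating functions
  set H : ℕ → V → ℝ := fun j y => C * B₁ * U j y + (∑ a, (C * (B₀ + B₂ a) *
    (mollify μ (ρ j) (fun z => N.indicator (F a) z ^ 2) y +
      mollify μ (ρ j) (fun z => N.indicator (D a) z ^ 2) y)
    + (tsupport φ).indicator (fun _ => C * B₂ a) y)) with hH
  set H₀ : V → ℝ := fun y => C * B₁ * N.indicator u y + (∑ a, (C * (B₀ + B₂ a) *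
    (N.indicator (F a) y ^ 2 + N.indicator (D a) y ^ 2)
    + (tsupport φ).indicator (fun _ => C * B₂ a) y)) with hH₀
  have ii : ∀ c : ℝ, Integrable ((tsupport φ).indicator (fun _ : V => c)) μ := fun c =>
    (integrable_indicator_iff (isClosed_tsupport φ).measurableSet).2
      (integrableOn_const hφc.isCompact.measure_lt_top.ne)
  have iH₁ : ∀ a, Integrable (fun y => C * (B₀ + B₂ a) *
      (N.indicator (F a) y ^ 2 + N.indicator (D a) y ^ 2)
      + (tsupport φ).indicator (fun _ => C * B₂ a) y) μ := fun a =>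
    (((iF2 a).add (iD2 a)).const_mul _).add (ii _)
  have iH₀ : Integrable H₀ μ :=
    (iu.const_mul _).add (integrable_finsetSum _ fun a _ => iH₁ a)
  have iH₂ : ∀ j a, Integrable (fun y => C * (B₀ + B₂ a) *
      (mollify μ (ρ j) (fun z => N.indicator (F a) z ^ 2) y +
        mollify μ (ρ j) (fun z => N.indicator (D a) z ^ 2) y)
      + (tsupport φ).indicator (fun _ => C * B₂ a) y) μ := fun j a =>
    (((integrable_mollify _ (iF2 a)).add (integrable_mollify _ (iD2 a))).const_mul _).add (ii _)
  have iH : ∀ j, Integrable (H j) μ := fun j =>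
    ((integrable_mollify _ iu).const_mul _).add (integrable_finsetSum _ fun a _ => iH₂ j a)
  -- Mollification preserves integrals, so all the bounds have the same integral.
  have hHI : ∀ j, ∫ y, H j y ∂μ = ∫ y, H₀ y ∂μ := fun j => by
    simp only [hH, hH₀]
    rw [integral_add ((integrable_mollify _ iu).const_mul _)
        (integrable_finsetSum _ fun a _ => iH₂ j a),
      integral_add (iu.const_mul _) (integrable_finsetSum _ fun a _ => iH₁ a),
      integral_const_mul, integral_const_mul, integral_mollify _ iu,
      integral_finsetSum _ fun a _ => iH₂ j a, integral_finsetSum _ fun a _ => iH₁ a]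
    congr 1
    refine Finset.sum_congr rfl fun a _ => ?_
    have i1 : Integrable (fun y => C * (B₀ + B₂ a) *
        (mollify μ (ρ j) (fun z => N.indicator (F a) z ^ 2) y +
          mollify μ (ρ j) (fun z => N.indicator (D a) z ^ 2) y)) μ :=
      ((integrable_mollify _ (iF2 a)).add (integrable_mollify _ (iD2 a))).const_mul _
    have i2 : Integrable (fun y => C * (B₀ + B₂ a) *
        (N.indicator (F a) y ^ 2 + N.indicator (D a) y ^ 2)) μ :=
      ((iF2 a).add (iD2 a)).const_mul _
    rw [integral_add i1 (ii _), integral_add i2 (ii _),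
      integral_const_mul, integral_const_mul,
      integral_add (integrable_mollify _ (iF2 a)) (integrable_mollify _ (iD2 a)),
      integral_add (iF2 a) (iD2 a), integral_mollify _ (iF2 a), integral_mollify _ (iD2 a)]
  -- The limit of `Fm * Dm` is controlled only in `L¹`, so no fixed bound is at hand. Jensen's
  -- inequality bounds the product by mollified squares, which vary with `j` but converge almost
  -- everywhere with constant integral.
  have hJH : ∀ j y, |J j y| ≤ H j y := by
    intro j y
    have hF2 := fun a => sq_mollify_le (ρ j) (iF a) (iF2 a) y
    have hD2 := fun a => sq_mollify_le (ρ j) (iD a) (iD2 a) y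
    simp only [hJ, hH]
    refine (abs_sub _ _).trans (add_le_add ?_ ((Finset.abs_sum_le_sum_abs _ _).trans
      (Finset.sum_le_sum fun a _ => ?_)))
    · rw [abs_mul]
      calc |G (U j y)| * |fderiv ℝ φ y τ| ≤ (C * U j y) * B₁ :=
            mul_le_mul (hGb _ (hU0 j y)) (hB₁ y) (abs_nonneg _) (mul_nonneg hC (hU0 j y))
        _ = _ := by ring
    · by_cases hy : y ∈ tsupport φ
      · rw [indicator_of_mem hy, abs_mul]
        have h1 : |g' (U j y) * Dm j a y * φ y + g (U j y) * fderiv ℝ φ y (e a)|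
            ≤ C * |Dm j a y| * B₀ + C * B₂ a := by
          refine (abs_add_le _ _).trans (add_le_add ?_ ?_)
          · rw [abs_mul, abs_mul]
            exact mul_le_mul (mul_le_mul_of_nonneg_right (hgb' _ (hU0 j y)) (abs_nonneg _)) (hB₀ y)
              (abs_nonneg _) (mul_nonneg hC (abs_nonneg _))
          · rw [abs_mul]
            exact mul_le_mul (hgb _ (hU0 j y)) (hB₂ a y) (abs_nonneg _) hC
        have h2 := mul_le_mul_of_nonneg_left h1 (abs_nonneg (Fm j a y))
        refine h2.trans ?_
        have h3 : |Fm j a y| * |Dm j a y| ≤ Fm j a y ^ 2 + Dm j a y ^ 2 := by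
          rw [← sq_abs (Fm j a y), ← sq_abs (Dm j a y)]
          nlinarith [sq_nonneg (|Fm j a y| - |Dm j a y|), sq_nonneg (|Fm j a y|),
            sq_nonneg (|Dm j a y|)]
        have h4 : |Fm j a y| ≤ Fm j a y ^ 2 + 1 := by
          rw [← sq_abs (Fm j a y)]
          nlinarith [sq_nonneg (|Fm j a y| - 1)]
        have hCB : 0 ≤ C * B₀ := mul_nonneg hC hB₀0
        have hCB2 : 0 ≤ C * B₂ a := mul_nonneg hC (hB₂0 a)
        have h5 : Fm j a y ^ 2 + Dm j a y ^ 2 ≤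
          mollify μ (ρ j) (fun z => N.indicator (F a) z ^ 2) y +
            mollify μ (ρ j) (fun z => N.indicator (D a) z ^ 2) y := add_le_add (hF2 a) (hD2 a)
        have h6 : Fm j a y ^ 2 ≤
          mollify μ (ρ j) (fun z => N.indicator (F a) z ^ 2) y +
            mollify μ (ρ j) (fun z => N.indicator (D a) z ^ 2) y := by
          linarith [hF2 a, (sq_nonneg _).trans (hD2 a)]
        calc |Fm j a y| * (C * |Dm j a y| * B₀ + C * B₂ a)
            = C * B₀ * (|Fm j a y| * |Dm j a y|) + C * B₂ a * |Fm j a y| := by ring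
          _ ≤ C * B₀ * (Fm j a y ^ 2 + Dm j a y ^ 2) + C * B₂ a * (Fm j a y ^ 2 + 1) :=
            add_le_add (mul_le_mul_of_nonneg_left h3 hCB) (mul_le_mul_of_nonneg_left h4 hCB2)
          _ ≤ _ := by
            linarith [mul_le_mul_of_nonneg_left h5 hCB, mul_le_mul_of_nonneg_left h6 hCB2]
      · rw [(hout y hy).1, (hout y hy).2]
        have h1 := (sq_nonneg _).trans (hF2 a)
        have h2 := (sq_nonneg _).trans (hD2 a)
        have h3 : 0 ≤ C * (B₀ + B₂ a) := mul_nonneg hC (add_nonneg hB₀0 (hB₂0 a))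
        simpa [hy] using mul_nonneg h3 (add_nonneg h1 h2)
  -- almost everywhere limits
  have tu := ae_tendsto_mollify hρ0 hρ2 iu.locallyIntegrable
  have tF : ∀ᵐ y ∂μ, ∀ a, Tendsto (fun j => Fm j a y) atTop (𝓝 (N.indicator (F a) y)) :=
    ae_all_iff.2 fun a => ae_tendsto_mollify hρ0 hρ2 (iF a).locallyIntegrable
  have tD : ∀ᵐ y ∂μ, ∀ a, Tendsto (fun j => Dm j a y) atTop (𝓝 (N.indicator (D a) y)) :=
    ae_all_iff.2 fun a => ae_tendsto_mollify hρ0 hρ2 (iD a).locallyIntegrable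
  have tF2 : ∀ᵐ y ∂μ, ∀ a, Tendsto (fun j => mollify μ (ρ j) (fun z => N.indicator (F a) z ^ 2) y)
      atTop (𝓝 (N.indicator (F a) y ^ 2)) :=
    ae_all_iff.2 fun a => ae_tendsto_mollify hρ0 hρ2 (iF2 a).locallyIntegrable
  have tD2 : ∀ᵐ y ∂μ, ∀ a, Tendsto (fun j => mollify μ (ρ j) (fun z => N.indicator (D a) z ^ 2) y)
      atTop (𝓝 (N.indicator (D a) y ^ 2)) :=
    ae_all_iff.2 fun a => ae_tendsto_mollify hρ0 hρ2 (iD2 a).locallyIntegrable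
  have tH : ∀ᵐ y ∂μ, Tendsto (fun j => H j y) atTop (𝓝 (H₀ y)) := by
    filter_upwards [tu, tF2, tD2] with y h1 h2 h3
    exact (h1.const_mul _).add (tendsto_finsetSum _ fun a _ =>
      (((h2 a).add (h3 a)).const_mul _).add tendsto_const_nhds)
  have tJ : ∀ᵐ y ∂μ, Tendsto (fun j => J j y) atTop (𝓝 (G (u y) * fderiv ℝ φ y τ
      - ∑ a, F a y * (g' (u y) * D a y * φ y + g (u y) * fderiv ℝ φ y (e a)))) := by
    filter_upwards [tu, tF, tD, hu0'] with y h1 h2 h3 h0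
    by_cases hy : y ∈ tsupport φ
    · have hyN := hφN hy
      simp only [indicator_of_mem hyN] at h1 h2 h3
      have h0' : 0 ≤ u y := by simpa [hyN] using h0
      have c1 := (hG _ h0').continuousAt.tendsto.comp h1
      have c2 := (hg _ h0').continuousAt.tendsto.comp h1
      have c3 : Tendsto (fun j => g' (U j y)) atTop (𝓝 (g' (u y))) :=
        (hg'c _ h0').tendsto.comp (tendsto_nhdsWithin_iff.2
          ⟨h1, Eventually.of_forall fun j => hU0 j y⟩)
      exact (c1.mul_const _).sub (tendsto_finsetSum _ fun a _ =>
        (h2 a).mul (((c3.mul (h3 a)).mul_const _).add (c2.mul_const _)))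
    · simp only [hJ, (hout y hy).1, (hout y hy).2]
      simp
  have hlim := tendsto_integral_of_tendsto_bound (fun j => (hJc j).aestronglyMeasurable) iH iH₀
    (fun j => Eventually.of_forall (hJH j)) tJ tH (by simp_rw [hHI]; exact tendsto_const_nhds)
  refine ⟨?_, ?_⟩
  · refine iH₀.mono' (aestronglyMeasurable_of_tendsto_ae atTop
      (fun j => (hJc j).aestronglyMeasurable) tJ) ?_
    filter_upwards [tJ, tH] with y h1 h2
    exact le_of_tendsto_of_tendsto' h1.abs h2 (fun j => hJH j y)
  · simp_rw [hJ0] at hlim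
    exact tendsto_nhds_unique hlim tendsto_const_nhds

end Renormalized


/-! ### The renormalizing function and its weight. -/

/-- The bounded decreasing function `(κ^{1-α} + (s+ε)^{1-α})^{-α/(1-α)}`. -/
noncomputable def renorm (α κ ε s : ℝ) : ℝ :=
  (κ ^ (1 - α) + (s + ε) ^ (1 - α)) ^ (-(α / (1 - α)))

/-- Minus the derivative of `renorm`. -/
noncomputable def renormWeight (α κ ε s : ℝ) : ℝ :=
  α * (s + ε) ^ (-α) * (κ ^ (1 - α) + (s + ε) ^ (1 - α)) ^ (-(1 / (1 - α)))

/-- The primitive of `renorm`. -/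
noncomputable def renormPrimitive (α κ ε s : ℝ) : ℝ := ∫ t in (0:ℝ)..s, renorm α κ ε t

section Renorm

variable {α κ ε s : ℝ}

theorem hasDerivAt_renorm (hα : 0 < α) (hα' : α < 1) (hκ : 0 < κ) (hs : 0 < s + ε) :
    HasDerivAt (renorm α κ ε) (-renormWeight α κ ε s) s := by
  have ha : (0:ℝ) < 1 - α := by linarith
  have h1 : HasDerivAt (fun s => s + ε) 1 s := (hasDerivAt_id s).add_const ε
  have h2 : HasDerivAt (fun s => (s + ε) ^ (1 - α)) (1 * (1 - α) * (s + ε) ^ (1 - α - 1)) s :=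
    h1.rpow_const (Or.inl hs.ne')
  have hb : 0 < κ ^ (1 - α) + (s + ε) ^ (1 - α) := by positivity
  have h3 := (h2.const_add (κ ^ (1 - α))).rpow_const (p := -(α / (1 - α))) (Or.inl hb.ne')
  refine h3.congr_deriv ?_
  unfold renormWeight
  rw [show -(α / (1 - α)) - 1 = -(1 / (1 - α)) by field_simp; ring,
    show 1 - α - 1 = -α by ring]
  field_simp

theorem renorm_nonneg (hκ : 0 < κ) (hs : 0 ≤ s + ε) : 0 ≤ renorm α κ ε s := by
  unfold renorm; positivity

theorem renorm_le (hα : 0 < α) (hα' : α < 1) (hκ : 0 < κ) (hs : 0 ≤ s + ε) :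
    renorm α κ ε s ≤ κ ^ (-α) := by
  have ha : (0:ℝ) < 1 - α := by linarith
  unfold renorm
  calc (κ ^ (1 - α) + (s + ε) ^ (1 - α)) ^ (-(α / (1 - α)))
      ≤ (κ ^ (1 - α)) ^ (-(α / (1 - α))) :=
        Real.rpow_le_rpow_of_nonpos (by positivity)
          (le_add_of_nonneg_right (by positivity)) (neg_nonpos.2 (by positivity))
    _ = κ ^ (-α) := by
      rw [← Real.rpow_mul hκ.le]
      congr 1
      field_simp

theorem abs_renorm_le (hα : 0 < α) (hα' : α < 1) (hκ : 0 < κ) (hs : 0 ≤ s + ε) :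
    |renorm α κ ε s| ≤ κ ^ (-α) := by
  rw [abs_of_nonneg (renorm_nonneg hκ hs)]
  exact renorm_le hα hα' hκ hs

theorem renormWeight_pos (hα : 0 < α) (hκ : 0 < κ) (hs : 0 < s + ε) :
    0 < renormWeight α κ ε s := by
  unfold renormWeight; positivity

theorem base_rpow_le (hα' : α < 1) {b c : ℝ} (hc : 0 < c)
    (h : c ^ (1 - α) ≤ b) : b ^ (-(1 / (1 - α))) ≤ c⁻¹ := by
  have ha : (0:ℝ) < 1 - α := by linarith
  calc b ^ (-(1 / (1 - α))) ≤ (c ^ (1 - α)) ^ (-(1 / (1 - α))) :=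
        Real.rpow_le_rpow_of_nonpos (by positivity) h (neg_nonpos.2 (by positivity))
    _ = c⁻¹ := by
      rw [← Real.rpow_mul hc.le, ← Real.rpow_neg_one]
      congr 1
      field_simp

/-- This is the purpose of `ε`: without the shift the weight is unbounded at `s = 0` and `renorm`
could not be used in the renormalized equation. The bound degenerates as `ε → 0`, but the energy
estimate does not depend on it. -/
theorem renormWeight_le (hα : 0 < α) (hα' : α < 1) (hκ : 0 < κ) (hε : 0 < ε) (hs : 0 ≤ s) :
    renormWeight α κ ε s ≤ α * ε ^ (-α) * κ⁻¹ := by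
  unfold renormWeight
  have h1 : (s + ε) ^ (-α) ≤ ε ^ (-α) :=
    Real.rpow_le_rpow_of_nonpos hε (by linarith) (by linarith)
  have h2 : (κ ^ (1 - α) + (s + ε) ^ (1 - α)) ^ (-(1 / (1 - α))) ≤ κ⁻¹ :=
    base_rpow_le hα' hκ (le_add_of_nonneg_right (by positivity))
  exact mul_le_mul (mul_le_mul_of_nonneg_left h1 hα.le) h2 (by positivity) (by positivity)

theorem continuousOn_renormWeight (hκ : 0 < κ) (hε : 0 < ε) :
    ContinuousOn (renormWeight α κ ε) (Ici 0) := by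
  intro s hs
  have hs' : 0 < s + ε := add_pos_of_nonneg_of_pos hs hε
  have hb : 0 < κ ^ (1 - α) + (s + ε) ^ (1 - α) := by positivity
  have h1 : ContinuousAt (fun s => s + ε) s := by fun_prop
  exact ((continuousAt_const.mul (h1.rpow_const (Or.inl hs'.ne'))).mul
    ((continuousAt_const.add (h1.rpow_const (Or.inl hs'.ne'))).rpow_const
      (Or.inl hb.ne'))).continuousWithinAt

theorem measurable_renormWeight : Measurable (renormWeight α κ ε) := by
  unfold renormWeight; fun_prop

theorem measurable_renorm : Measurable (renorm α κ ε) := by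
  unfold renorm; fun_prop

/-- Controls the lower order term `K u^(2-α)` of the dissipation. The product is at most `s^(1-2α)`,
whose exponent lies in `(0, 1)`, so it is linear in `s + κ` at the price of `κ^(-2α)`. -/
theorem rpow_mul_renormWeight_le (hα : 0 < α) (hα' : α < 1 / 2) (hκ : 0 < κ) (hε : 0 < ε)
    (hs : 0 ≤ s) : s ^ (2 - α) * renormWeight α κ ε s ≤ κ ^ (-(2 * α)) * (s + κ) := by
  rcases hs.eq_or_lt with rfl | hs
  · rw [Real.zero_rpow (by linarith), zero_mul]; positivity
  have h1 : (s + ε) ^ (-α) ≤ s ^ (-α) :=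
    Real.rpow_le_rpow_of_nonpos hs (by linarith) (by linarith)
  have h2 : (κ ^ (1 - α) + (s + ε) ^ (1 - α)) ^ (-(1 / (1 - α))) ≤ s⁻¹ :=
    base_rpow_le (by linarith) hs ((Real.rpow_le_rpow hs.le (by linarith) (by linarith)).trans
      (le_add_of_nonneg_left (by positivity)))
  calc s ^ (2 - α) * renormWeight α κ ε s ≤ s ^ (2 - α) * (1 * s ^ (-α) * s⁻¹) := by
        unfold renormWeight
        refine mul_le_mul_of_nonneg_left ?_ (by positivity)
        exact mul_le_mul (mul_le_mul (by linarith) h1 (by positivity) (by norm_num)) h2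
          (by positivity) (by positivity)
    _ = s ^ (1 - 2 * α) := by
        rw [one_mul, ← Real.rpow_neg_one s, ← Real.rpow_add hs, ← Real.rpow_add hs]
        congr 1; ring
    _ ≤ (s + κ) ^ (1 - 2 * α) := Real.rpow_le_rpow hs.le (by linarith) (by linarith)
    _ = (s + κ) ^ (-(2 * α)) * (s + κ) := by
        rw [sub_eq_neg_add, Real.rpow_add (by linarith), Real.rpow_one]
    _ ≤ κ ^ (-(2 * α)) * (s + κ) := by
        refine mul_le_mul_of_nonneg_right ?_ (by linarith)
        exact Real.rpow_le_rpow_of_nonpos hκ (by linarith) (by linarith)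

/-- The reason for the choice of weight: the factor `s^α` cancels the singularity of `D ≤ K u^(-α)`,
so that `|F|²` is at most a multiple of `u + κ` times the weighted dissipation. -/
theorem one_le_renormWeight_mul (hα : 0 < α) (hα' : α < 1 / 2) (hκ : 0 < κ) (hs : 0 < s) :
    1 ≤ 4 / α * s ^ α * (s + κ) * renormWeight α κ 0 s := by
  have ha : (0:ℝ) < 1 - α := by linarith
  unfold renormWeight
  rw [add_zero]
  have hb : 0 < κ ^ (1 - α) + s ^ (1 - α) := by positivity
  have h1 : (κ ^ (1 - α) + s ^ (1 - α)) ^ (1 / (1 - α)) ≤ 4 * (s + κ) := by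
    have h2 : κ ^ (1 - α) + s ^ (1 - α) ≤ 2 * (s + κ) ^ (1 - α) := by
      linarith [Real.rpow_le_rpow hκ.le (by linarith : κ ≤ s + κ) ha.le,
        Real.rpow_le_rpow hs.le (by linarith : s ≤ s + κ) ha.le]
    calc (κ ^ (1 - α) + s ^ (1 - α)) ^ (1 / (1 - α))
        ≤ (2 * (s + κ) ^ (1 - α)) ^ (1 / (1 - α)) :=
          Real.rpow_le_rpow hb.le h2 (by positivity)
      _ = 2 ^ (1 / (1 - α)) * (s + κ) := by
          rw [Real.mul_rpow (by norm_num) (by positivity), ← Real.rpow_mul (by positivity),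
            mul_one_div_cancel ha.ne', Real.rpow_one]
      _ ≤ 2 ^ (2:ℝ) * (s + κ) := by
          -- Here `1 / (1 - α) ≤ 2` because `α < 1 / 2`; this is the origin of the constant `4`.
          refine mul_le_mul_of_nonneg_right ?_ (by linarith)
          refine Real.rpow_le_rpow_of_exponent_le (by norm_num) ?_
          rw [div_le_iff₀ ha]; linarith
      _ = 4 * (s + κ) := by norm_num
  rw [Real.rpow_neg hs.le, Real.rpow_neg hb.le]
  have hb' : 0 < (κ ^ (1 - α) + s ^ (1 - α)) ^ (1 / (1 - α)) := by positivity
  have hsα : 0 < s ^ α := by positivity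
  rw [show 4 / α * s ^ α * (s + κ) * (α * (s ^ α)⁻¹ *
    ((κ ^ (1 - α) + s ^ (1 - α)) ^ (1 / (1 - α)))⁻¹) =
    (4 * (s + κ)) / (κ ^ (1 - α) + s ^ (1 - α)) ^ (1 / (1 - α)) by field_simp]
  rwa [one_le_div hb']

theorem tendsto_renormWeight (hκ : 0 < κ) (hs : 0 < s) {e : ℕ → ℝ}
    (he : Tendsto e atTop (𝓝 0)) :
    Tendsto (fun j => renormWeight α κ (e j) s) atTop (𝓝 (renormWeight α κ 0 s)) := by
  unfold renormWeight
  have h1 : Tendsto (fun j => s + e j) atTop (𝓝 (s + 0)) := he.const_add s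
  have hb : 0 < κ ^ (1 - α) + (s + 0) ^ (1 - α) := by
    rw [add_zero]; positivity
  have h2 : s + 0 ≠ 0 := by rw [add_zero]; exact hs.ne'
  exact (tendsto_const_nhds.mul (h1.rpow_const (Or.inl h2))).mul
    ((tendsto_const_nhds.add (h1.rpow_const (Or.inl h2))).rpow_const (Or.inl hb.ne'))

/-- Needed on the set `u = 0`, where `D u^α ≤ K` says nothing about `D`: the blow-up of the weight
takes the place of that bound. -/
theorem tendsto_renormWeight_zero (hα : 0 < α) (hα' : α < 1) (hκ : 0 < κ) {e : ℕ → ℝ}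
    (he0 : ∀ j, 0 < e j) (he : Tendsto e atTop (𝓝 0)) :
    Tendsto (fun j => renormWeight α κ (e j) 0) atTop atTop := by
  unfold renormWeight
  simp only [zero_add]
  have h1 : Tendsto (fun j => e j ^ (-α)) atTop atTop := by
    refine (tendsto_rpow_neg_nhdsGT_zero (neg_lt_zero.2 hα)).comp ?_
    exact tendsto_nhdsWithin_iff.2 ⟨he, Eventually.of_forall he0⟩
  have hb : 0 < κ ^ (1 - α) + (0:ℝ) ^ (1 - α) := by positivity
  have h2 : Tendsto (fun j => (κ ^ (1 - α) + e j ^ (1 - α)) ^ (-(1 / (1 - α)))) atTop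
      (𝓝 ((κ ^ (1 - α) + (0:ℝ) ^ (1 - α)) ^ (-(1 / (1 - α))))) :=
    (tendsto_const_nhds.add (he.rpow_const (Or.inr (by linarith)))).rpow_const (Or.inl hb.ne')
  exact (h1.const_mul_atTop hα).atTop_mul_pos (by positivity) h2

theorem hasDerivAt_renormPrimitive (hα : 0 < α) (hα' : α < 1) (hκ : 0 < κ) (hε : 0 < ε)
    (hs : 0 ≤ s) : HasDerivAt (renormPrimitive α κ ε) (renorm α κ ε s) s := by
  have hc : ∀ t, 0 ≤ t → ContinuousAt (renorm α κ ε) t := fun t ht =>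
    (hasDerivAt_renorm hα hα' hκ (by linarith)).continuousAt
  refine intervalIntegral.integral_hasDerivAt_right ?_ ?_ (hc s hs)
  · refine ContinuousOn.intervalIntegrable fun t ht => (hc t ?_).continuousWithinAt
    rw [uIcc_of_le hs] at ht
    exact ht.1
  · exact measurable_renorm.stronglyMeasurable.stronglyMeasurableAtFilter

theorem renormPrimitive_nonneg (hκ : 0 < κ) (hε : 0 < ε) (hs : 0 ≤ s) :
    0 ≤ renormPrimitive α κ ε s :=
  intervalIntegral.integral_nonneg hs fun t ht => renorm_nonneg hκ (by linarith [ht.1])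

theorem renormPrimitive_le (hα : 0 < α) (hα' : α < 1) (hκ : 0 < κ) (hε : 0 < ε) (hs : 0 ≤ s) :
    renormPrimitive α κ ε s ≤ κ ^ (-α) * s := by
  have := intervalIntegral.norm_integral_le_of_norm_le_const (a := 0) (b := s)
    (f := renorm α κ ε) (C := κ ^ (-α)) (fun t ht => by
      rw [uIoc_of_le hs] at ht
      exact abs_renorm_le hα hα' hκ (by linarith [ht.1]))
  rw [sub_zero, abs_of_nonneg hs] at this
  exact (le_abs_self _).trans this

end Renorm


/-! ### The scalar equation and its test functions. -/

/-- A nonnegative scalar solution of `u_t = ∇ · F` whose flux is square integrable and satisfies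
`|F|² ≤ D (F · ∇u + K u^{2-α})` with a coefficient `D ≤ K u^{-α}`. -/
structure ScalarSolution {n : ℕ} (α K : ℝ) (u0 : Space n → ℝ) (u : Space n → ℝ → ℝ)
    (F Du : Space n × ℝ → Space n) : Prop where
  locallyIntegrable :
    LocallyIntegrableOn (fun y : Space n × ℝ => u y.1 y.2) (univ ×ˢ Ici 0)
  locallyIntegrable_slice : ∀ t : ℝ, 0 < t → LocallyIntegrable (fun x => u x t)
  nonneg : ∀ᵐ y ∂(volume.restrict (domain n)), 0 ≤ u y.1 y.2
  weakGradient : IsWeakGradient (fun y : Space n × ℝ => u y.1 y.2) Du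
  gradient_sq : ∀ K : Set (Space n × ℝ), IsCompact K → K ⊆ domain n →
    MemLp Du 2 (volume.restrict K)
  flux_sq : ∀ T : ℝ, 0 < T → MemLp F 2 (volume.restrict (slab n T))
  weak_form : ∀ T : ℝ, 0 < T → ∀ φ : Space n × ℝ → ℝ, ContDiff ℝ ∞ φ → HasCompactSupport φ →
      (∫ x, u x T * φ (x, T)) - ∫ x, u0 x * φ (x, 0) =
        ∫ y in slab n T, (u y.1 y.2 * fderiv ℝ φ y (0, 1) - fderiv ℝ φ y (F y, 0))
  flux_le : ∀ᵐ y ∂(volume.restrict (domain n)), ∃ D : ℝ, 0 ≤ D ∧ D * u y.1 y.2 ^ α ≤ K ∧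
    0 ≤ inner ℝ (F y) (Du y) + K * u y.1 y.2 ^ (2 - α) ∧
    ‖F y‖ ^ 2 ≤ D * (inner ℝ (F y) (Du y) + K * u y.1 y.2 ^ (2 - α))

theorem measurableSet_slab (n : ℕ) (T : ℝ) : MeasurableSet (slab n T) :=
  MeasurableSet.univ.prod measurableSet_Ioc

theorem isOpen_domain (n : ℕ) : IsOpen (domain n) := isOpen_univ.prod isOpen_Ioi

theorem slab_subset_domain (n : ℕ) (T : ℝ) : slab n T ⊆ domain n :=
  prod_mono_right fun _ h => h.1

theorem ae_slab_of_ae_domain {n : ℕ} {T : ℝ} {p : Space n × ℝ → Prop}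
    (h : ∀ᵐ y ∂(volume.restrict (domain n)), p y) : ∀ᵐ y ∂(volume.restrict (slab n T)), p y :=
  ae_restrict_of_ae_restrict_of_subset (slab_subset_domain n T) h

theorem integrableOn_slab_mul {n : ℕ} {T : ℝ} {K : Set (Space n)}
    {h c : Space n × ℝ → ℝ} {C : ℝ} (hh : IntegrableOn h (K ×ˢ Ioc 0 T))
    (hc : AEStronglyMeasurable c (volume.restrict (K ×ˢ Ioc 0 T))) (hC : ∀ y, |c y| ≤ C)
    (h0 : ∀ y, y.1 ∉ K → c y = 0) :
    IntegrableOn (fun y => h y * c y) (slab n T) := by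
  have h1 : IntegrableOn (fun y => h y * c y) (K ×ˢ Ioc 0 T) :=
    hh.mul_bdd (c := C) hc (Eventually.of_forall hC)
  refine h1.of_forall_sdiff_eq_zero (measurableSet_slab n T) fun y hy => ?_
  have : y.1 ∉ K := fun h => hy.2 ⟨h, hy.1.2⟩
  simp [h0 y this]

theorem inner_eq_sum {n : ℕ} (v w : Space n) : inner ℝ v w = ∑ a, v a * w a := by
  simp [PiLp.inner_apply, mul_comm]

theorem clm_prod_eq_sum {n : ℕ} (L : Space n × ℝ →L[ℝ] ℝ) (v : Space n) :
    L (v, 0) = ∑ a, v a * L (EuclideanSpace.single a 1, 0) := by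
  have h1 : v = ∑ a, v a • EuclideanSpace.single a (1:ℝ) := by
    ext b; simp [Finset.sum_apply, Pi.single_apply]
  have h2 : ((v, 0) : Space n × ℝ)
      = ContinuousLinearMap.inl ℝ (Space n) ℝ v := rfl
  rw [h2]
  conv_lhs => rw [h1]
  simp_rw [map_sum, map_smul, smul_eq_mul, ContinuousLinearMap.inl_apply]

theorem fderiv_mul_separated {n : ℕ} {ζ : Space n → ℝ} {χ : ℝ → ℝ} (hζ : ContDiff ℝ ∞ ζ)
    (hχ : ContDiff ℝ ∞ χ) (y : Space n × ℝ) (v : Space n) (r : ℝ) :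
    fderiv ℝ (fun y : Space n × ℝ => ζ y.1 * χ y.2) y (v, r)
      = χ y.2 * fderiv ℝ ζ y.1 v + ζ y.1 * (deriv χ y.2 * r) := by
  have h1 : HasFDerivAt (fun y : Space n × ℝ => ζ y.1)
      ((fderiv ℝ ζ y.1).comp (ContinuousLinearMap.fst ℝ (Space n) ℝ)) y :=
    (hζ.differentiable (by simp) y.1).hasFDerivAt.comp y hasFDerivAt_fst
  have h2 : HasFDerivAt (fun y : Space n × ℝ => χ y.2)
      (deriv χ y.2 • (ContinuousLinearMap.snd ℝ (Space n) ℝ)) y :=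
    (hχ.differentiable (by simp) y.2).hasDerivAt.comp_hasFDerivAt y hasFDerivAt_snd
  rw [show fderiv ℝ (fun y : Space n × ℝ => ζ y.1 * χ y.2) y = _ from (h1.mul h2).fderiv]
  simp
  ring

theorem contDiff_mul_separated {n : ℕ} {ζ : Space n → ℝ} {χ : ℝ → ℝ} (hζ : ContDiff ℝ ∞ ζ)
    (hχ : ContDiff ℝ ∞ χ) : ContDiff ℝ ∞ (fun y : Space n × ℝ => ζ y.1 * χ y.2) :=
  (hζ.comp contDiff_fst).mul (hχ.comp contDiff_snd)

theorem tsupport_mul_separated {n : ℕ} (ζ : Space n → ℝ) (χ : ℝ → ℝ) :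
    tsupport (fun y : Space n × ℝ => ζ y.1 * χ y.2) ⊆ tsupport ζ ×ˢ tsupport χ := by
  refine closure_minimal (fun y hy => ?_) ((isClosed_tsupport ζ).prod (isClosed_tsupport χ))
  have hy' : ζ y.1 * χ y.2 ≠ 0 := hy
  exact ⟨subset_tsupport _ (left_ne_zero_of_mul hy'), subset_tsupport _ (right_ne_zero_of_mul hy')⟩

theorem hasCompactSupport_mul_separated {n : ℕ} {ζ : Space n → ℝ} {χ : ℝ → ℝ}
    (hζ : HasCompactSupport ζ) (hχ : HasCompactSupport χ) :
    HasCompactSupport (fun y : Space n × ℝ => ζ y.1 * χ y.2) :=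
  (hζ.isCompact.prod hχ.isCompact).of_isClosed_subset (isClosed_tsupport _)
    (tsupport_mul_separated ζ χ)

namespace ScalarSolution

variable {n : ℕ} {α K : ℝ} {u0 : Space n → ℝ} {u : Space n → ℝ → ℝ}
  {F Du : Space n × ℝ → Space n}

theorem integrableOn_prod (h : ScalarSolution α K u0 u F Du) {B : Set (Space n)} (hB : IsCompact B)
    (T : ℝ) : IntegrableOn (fun y : Space n × ℝ => u y.1 y.2) (B ×ˢ Ioc 0 T) :=
  (h.locallyIntegrable.integrableOn_compact_subset (prod_mono (subset_univ _) fun _ hs => hs.1)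
    (hB.prod (isCompact_Icc (a := (0:ℝ)) (b := T)))).mono_set (prod_mono_right Ioc_subset_Icc_self)

theorem integrableOn_one {B : Set (Space n)} (hB : IsCompact B) (T : ℝ) :
    IntegrableOn (fun _ : Space n × ℝ => (1:ℝ)) (B ×ˢ Ioc 0 T) := by
  have : IntegrableOn (fun _ : Space n × ℝ => (1:ℝ)) (B ×ˢ Icc 0 T) :=
    integrableOn_const (hB.prod isCompact_Icc).measure_lt_top.ne
  exact this.mono_set (prod_mono_right Ioc_subset_Icc_self)

theorem integrableOn_flux (h : ScalarSolution α K u0 u F Du) {B : Set (Space n)} (hB : IsCompact B)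
    {T : ℝ} (hT : 0 < T) : IntegrableOn F (B ×ˢ Ioc 0 T) := by
  have h1 : MemLp F 2 (volume.restrict (B ×ˢ Ioc 0 T)) :=
    (h.flux_sq T hT).mono_measure (Measure.restrict_mono
      (prod_mono (subset_univ _) subset_rfl) le_rfl)
  have : IsFiniteMeasure ((volume : Measure (Space n × ℝ)).restrict (B ×ˢ Ioc 0 T)) :=
    ⟨by
      rw [Measure.restrict_apply_univ]
      exact (measure_mono (prod_mono_right Ioc_subset_Icc_self)).trans_lt
        (hB.prod isCompact_Icc).measure_lt_top⟩
  exact h1.integrable (by norm_num)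

theorem integrableOn_flux_apply (h : ScalarSolution α K u0 u F Du) {B : Set (Space n)}
    (hB : IsCompact B) {T : ℝ} (hT : 0 < T) (a : Fin n) :
    IntegrableOn (fun y => F y a) (B ×ˢ Ioc 0 T) :=
  (EuclideanSpace.proj (𝕜 := ℝ) a).integrable_comp (h.integrableOn_flux hB hT)

/-- The weak form for test functions supported in positive times. -/
theorem weak_form_domain (h : ScalarSolution α K u0 u F Du) {φ : Space n × ℝ → ℝ}
    (hφ : ContDiff ℝ ∞ φ) (hφc : HasCompactSupport φ) (hφd : tsupport φ ⊆ domain n) :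
    ∫ y in domain n, u y.1 y.2 * fderiv ℝ φ y (0, 1)
      = ∫ y in domain n, ∑ a, F y a * fderiv ℝ φ y (EuclideanSpace.single a 1, 0) := by
  -- A time strictly beyond the support, so that both boundary terms of the weak form vanish.
  obtain ⟨T, hT0, hT⟩ : ∃ T : ℝ, 0 < T ∧ ∀ y ∈ tsupport φ, y.2 < T := by
    obtain ⟨M, hM⟩ := (hφc.isCompact.image continuous_snd).bddAbove
    refine ⟨max M 0 + 1, by positivity, fun y hy => ?_⟩
    have := hM (mem_image_of_mem _ hy)
    linarith [le_max_left M 0]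
  have hB := hφc.isCompact.image continuous_fst
  have hd : ∀ v, Continuous fun y => fderiv ℝ φ y v := fun v =>
    (hφ.continuous_fderiv (by simp)).clm_apply continuous_const
  have h0 : ∀ y, y ∉ tsupport φ → ∀ v, fderiv ℝ φ y v = 0 := fun y hy v => by
    rw [fderiv_of_notMem_tsupport (𝕜 := ℝ) hy]; rfl
  have i : ∀ (f : Space n × ℝ → ℝ) (v),
      IntegrableOn f ((Prod.fst '' tsupport φ) ×ˢ Ioc 0 T) →
      IntegrableOn (fun y => f y * fderiv ℝ φ y v) (slab n T) := fun f v hf => by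
    obtain ⟨C, hC⟩ := (hφc.fderiv_apply (𝕜 := ℝ) v).exists_bound_of_continuous (hd v)
    exact integrableOn_slab_mul hf (hd v).aestronglyMeasurable hC
      fun y hy => h0 y (fun hy' => hy (mem_image_of_mem _ hy')) v
  have key := h.weak_form T hT0 φ hφ hφc
  have z1 : ∀ x, φ (x, T) = 0 := fun x => image_eq_zero_of_notMem_tsupport fun hx =>
    lt_irrefl _ (hT _ hx)
  have z2 : ∀ x, φ (x, 0) = 0 := fun x => image_eq_zero_of_notMem_tsupport fun hx =>
    lt_irrefl (0:ℝ) (hφd hx).2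
  simp only [z1, z2, mul_zero, integral_zero, sub_zero] at key
  simp_rw [fun y => clm_prod_eq_sum (fderiv ℝ φ y) (F y)] at key
  rw [integral_sub (i _ _ (h.integrableOn_prod hB T)) (integrable_finsetSum _ fun a _ =>
    i _ _ (h.integrableOn_flux_apply hB hT0 a))] at key
  have e : ∀ f : Space n × ℝ → ℝ, (∀ y, y ∉ tsupport φ → f y = 0) →
      ∫ y in domain n, f y = ∫ y in slab n T, f y := fun f hf =>
    setIntegral_eq_of_subset_of_forall_sdiff_eq_zero (isOpen_domain n).measurableSet
      (slab_subset_domain n T) fun y hy => hf y fun hy' =>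
        hy.2 ⟨mem_univ _, hy.1.2, (hT y hy').le⟩
  rw [e _ fun y hy => by simp [h0 y hy], e _ fun y hy => by simp [h0 y hy]]
  linarith

/-- This is `renormalized_identity` in space-time, with the spatial basis vectors as `e` and the
unit time vector as `τ`. -/
theorem renormalized (h : ScalarSolution α K u0 u F Du) {G g g' : ℝ → ℝ} {C : ℝ}
    (hG : ∀ s, 0 ≤ s → HasDerivAt G (g s) s)
    (hg : ∀ s, 0 ≤ s → HasDerivAt g (g' s) s) (hg'c : ContinuousOn g' (Ici 0))
    (hGb : ∀ s, 0 ≤ s → |G s| ≤ C * s) (hgb : ∀ s, 0 ≤ s → |g s| ≤ C)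
    (hgb' : ∀ s, 0 ≤ s → |g' s| ≤ C)
    {φ : Space n × ℝ → ℝ} (hφ : ContDiff ℝ ∞ φ) (hφc : HasCompactSupport φ)
    (hφΩ : tsupport φ ⊆ domain n) :
    Integrable (fun y => G (u y.1 y.2) * fderiv ℝ φ y (0, 1)
      - (g' (u y.1 y.2) * inner ℝ (F y) (Du y) * φ y + g (u y.1 y.2) * fderiv ℝ φ y (F y, 0))) ∧
    ∫ y, (G (u y.1 y.2) * fderiv ℝ φ y (0, 1)
      - (g' (u y.1 y.2) * inner ℝ (F y) (Du y) * φ y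
        + g (u y.1 y.2) * fderiv ℝ φ y (F y, 0))) = 0 := by
  have hcoord : ∀ (f : Space n × ℝ → Space n) (S : Set (Space n × ℝ)) (a : Fin n),
      MemLp f 2 (volume.restrict S) → MemLp (fun y => f y a) 2 (volume.restrict S) :=
    fun f S a hf => (EuclideanSpace.proj (𝕜 := ℝ) a).comp_memLp' hf
  have hFK : ∀ (S : Set (Space n × ℝ)), IsCompact S → S ⊆ domain n →
      MemLp F 2 (volume.restrict S) := fun S hS hSd => by
    obtain ⟨T, hT0, hT⟩ : ∃ T : ℝ, 0 < T ∧ ∀ y ∈ S, y.2 ≤ T := by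
      obtain ⟨M, hM⟩ := (hS.image continuous_snd).bddAbove
      exact ⟨max M 1, by positivity, fun y hy =>
        (hM (mem_image_of_mem _ hy)).trans (le_max_left _ _)⟩
    have hsub : S ⊆ slab n T := fun y hy => ⟨mem_univ _, (hSd hy).2, hT y hy⟩
    exact (h.flux_sq T hT0).mono_measure (Measure.restrict_mono hsub le_rfl)
  have : (volume : Measure (Space n × ℝ)).IsAddHaarMeasure := by
    rw [Measure.volume_eq_prod]; infer_instance
  have key := renormalized_identity (μ := (volume : Measure (Space n × ℝ))) (isOpen_domain n)
    (fun a : Fin n => ((EuclideanSpace.single a 1 : Space n), (0:ℝ))) (0, 1)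
    (u := fun y => u y.1 y.2) (F := fun a y => F y a) (D := fun a y => Du y a)
    (fun S hS hSd => h.weakGradient.1.integrableOn_compact_subset hSd hS)
    (fun a S hS hSd => hcoord F S a (hFK S hS hSd))
    (fun a S hS hSd => hcoord Du S a (h.gradient_sq S hS hSd)) h.nonneg
    (fun ψ h1 h2 h3 a => by
      have := h.weakGradient.2.2 ψ h1 h2 h3 (EuclideanSpace.single a 1)
      simpa [EuclideanSpace.inner_single_right] using this)
    (fun ψ h1 h2 h3 => h.weak_form_domain h1 h2 h3) hG hg hg'c hGb hgb hgb' hφ hφc hφΩ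
  have e : ∀ y, ∑ a, F y a * (g' (u y.1 y.2) * Du y a * φ y
      + g (u y.1 y.2) * fderiv ℝ φ y (EuclideanSpace.single a 1, 0))
      = g' (u y.1 y.2) * inner ℝ (F y) (Du y) * φ y + g (u y.1 y.2) * fderiv ℝ φ y (F y, 0) := by
    intro y
    rw [inner_eq_sum, clm_prod_eq_sum, Finset.mul_sum, Finset.mul_sum, Finset.sum_mul,
      ← Finset.sum_add_distrib]
    exact Finset.sum_congr rfl fun a _ => by ring
  simp_rw [e] at key
  exact key

end ScalarSolution


/-! ### The weighted energy estimate. -/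

/-- The function `F · ∇u + K u^{2-α}`. -/
noncomputable def dissipation {n : ℕ} (α K : ℝ) (u : Space n → ℝ → ℝ)
    (F Du : Space n × ℝ → Space n) (y : Space n × ℝ) : ℝ :=
  inner ℝ (F y) (Du y) + K * u y.1 y.2 ^ (2 - α)

/-- The density that controls the weighted dissipation. -/
noncomputable def energyDensity {n : ℕ} (α κ K L : ℝ) (χ : ℝ → ℝ) (η : Space n → ℝ)
    (u : Space n → ℝ → ℝ) (F : Space n × ℝ → Space n) (y : Space n × ℝ) : ℝ :=
  κ ^ (-α) * L * (u y.1 y.2 * η y.1 ^ 2) + K * κ ^ (-(2 * α)) * ((u y.1 y.2 + κ) * η y.1 ^ 2)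
    + κ ^ (-α) * (‖F y‖ * (χ y.2 * ‖fderiv ℝ (fun x => η x ^ 2) y.1‖))

namespace ScalarSolution

variable {n : ℕ} {α K : ℝ} {u0 : Space n → ℝ} {u : Space n → ℝ → ℝ}
  {F Du : Space n × ℝ → Space n}

theorem integrableOn_mul_spatial (h : ScalarSolution α K u0 u F Du) {f : Space n → ℝ}
    (hf : Continuous f) (hfc : HasCompactSupport f) {χ : ℝ → ℝ} (hχ : Continuous χ)
    {M : ℝ} (hM : ∀ s, |χ s| ≤ M) (T : ℝ) :
    IntegrableOn (fun y : Space n × ℝ => u y.1 y.2 * (χ y.2 * f y.1)) (slab n T) ∧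
    IntegrableOn (fun y : Space n × ℝ => χ y.2 * f y.1) (slab n T) ∧
    (0 < T → IntegrableOn (fun y : Space n × ℝ => ‖F y‖ * (χ y.2 * f y.1)) (slab n T)) := by
  obtain ⟨C, hC⟩ := hfc.exists_bound_of_continuous hf
  have hm : ∀ ν : Measure (Space n × ℝ),
      AEStronglyMeasurable (fun y : Space n × ℝ => χ y.2 * f y.1) ν := fun ν =>
    Continuous.aestronglyMeasurable (by fun_prop)
  have hb : ∀ y : Space n × ℝ, |χ y.2 * f y.1| ≤ M * C := fun y => by
    rw [abs_mul]
    exact mul_le_mul (hM _) (hC _) (abs_nonneg _) ((abs_nonneg _).trans (hM 0))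
  have h0 : ∀ y : Space n × ℝ, y.1 ∉ tsupport f → χ y.2 * f y.1 = 0 := fun y hy => by
    rw [image_eq_zero_of_notMem_tsupport hy, mul_zero]
  refine ⟨integrableOn_slab_mul (h.integrableOn_prod hfc.isCompact T) (hm _) hb h0, ?_,
    fun hT => integrableOn_slab_mul (h.integrableOn_flux hfc.isCompact hT).norm (hm _) hb h0⟩
  simpa using integrableOn_slab_mul (integrableOn_one hfc.isCompact T) (hm _) hb h0

theorem continuous_fderiv_sq {η : Space n → ℝ} (hη : ContDiff ℝ ∞ η) :
    Continuous fun x => ‖fderiv ℝ (fun x => η x ^ 2) x‖ :=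
  ((hη.pow 2).continuous_fderiv (by simp)).norm

theorem hasCompactSupport_sq {η : Space n → ℝ} (hηc : HasCompactSupport η) :
    HasCompactSupport fun x => η x ^ 2 := by
  simp_rw [sq]; exact hηc.mul_left

theorem hasCompactSupport_fderiv_sq {η : Space n → ℝ} (hηc : HasCompactSupport η) :
    HasCompactSupport fun x => ‖fderiv ℝ (fun x => η x ^ 2) x‖ :=
  ((hasCompactSupport_sq hηc).fderiv (𝕜 := ℝ)).norm

theorem norm_fderiv_sq {η : Space n → ℝ} (hη : ContDiff ℝ ∞ η) (x : Space n) :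
    ‖fderiv ℝ (fun x => η x ^ 2) x‖ = 2 * |η x| * ‖fderiv ℝ η x‖ := by
  have h1 := ((hη.differentiable (by simp) x).hasFDerivAt.pow 2)
  rw [show fderiv ℝ (fun x => η x ^ 2) x = _ from h1.fderiv, norm_smul]
  simp

theorem integrableOn_energyDensity (h : ScalarSolution α K u0 u F Du) {κ L : ℝ} {χ : ℝ → ℝ}
    (hχ : Continuous χ) (hχ1 : ∀ s, |χ s| ≤ 1) {η : Space n → ℝ} (hη : ContDiff ℝ ∞ η)
    (hηc : HasCompactSupport η) {T : ℝ} (hT : 0 < T) :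
    IntegrableOn (energyDensity α κ K L χ η u F) (slab n T) := by
  have hs := h.integrableOn_mul_spatial (f := fun x => η x ^ 2) (by fun_prop)
    (hasCompactSupport_sq hηc) (χ := fun _ => 1) continuous_const (M := 1) (by simp) T
  simp only [one_mul] at hs
  have hf := (h.integrableOn_mul_spatial (continuous_fderiv_sq hη)
    (hasCompactSupport_fderiv_sq hηc) hχ hχ1 T).2.2 hT
  have h2 : IntegrableOn (fun y : Space n × ℝ => (u y.1 y.2 + κ) * η y.1 ^ 2) (slab n T) := by
    simp_rw [add_mul]
    exact hs.1.add (hs.2.1.const_mul κ)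
  exact ((hs.1.const_mul _).add (h2.const_mul _)).add (hf.const_mul _)

/-- The weighted energy estimate for a fixed regularization of the weight. -/
theorem lintegral_dissipation_le (h : ScalarSolution α K u0 u F Du) (hα : 0 < α)
    (hα' : α < 1 / 2) (hK : 0 ≤ K) {κ ε L a T : ℝ} (hκ : 0 < κ) (hε : 0 < ε) (ha : 0 < a)
    (hT : 0 < T) (hL : 0 ≤ L) {χ χ' : ℝ → ℝ} (hχ : ContDiff ℝ ∞ χ) (hχs : tsupport χ ⊆ Icc a T)
    (hχ0 : ∀ s, 0 ≤ χ s) (hχL : ∀ s, -L ≤ deriv χ s) (hχ' : Continuous χ')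
    (hχχ' : ∀ s, χ s ≤ χ' s) (hχ'1 : ∀ s, |χ' s| ≤ 1)
    {η : Space n → ℝ} (hη : ContDiff ℝ ∞ η) (hηc : HasCompactSupport η) :
    ∫⁻ y in slab n T, ENNReal.ofReal (dissipation α K u F Du y
        * renormWeight α κ ε (u y.1 y.2) * (η y.1 ^ 2 * χ y.2))
      ≤ ENNReal.ofReal (∫ y in slab n T, energyDensity α κ K L χ' η u F y) := by
  have hα1 : α < 1 := by linarith
  set Γ := κ ^ (-α) with hΓ
  have hΓ0 : 0 < Γ := by positivity
  set φ : Space n × ℝ → ℝ := fun y => η y.1 ^ 2 * χ y.2 with hφ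
  have hχc : HasCompactSupport χ := isCompact_Icc.of_isClosed_subset (isClosed_tsupport _) hχs
  have hζ : ContDiff ℝ ∞ fun x => η x ^ 2 := hη.pow 2
  have hφs : tsupport φ ⊆ tsupport (fun x => η x ^ 2) ×ˢ tsupport χ :=
    tsupport_mul_separated (fun x => η x ^ 2) χ
  have hφslab : tsupport φ ⊆ slab n T := fun y hy =>
    ⟨mem_univ _, ha.trans_le (hχs (hφs hy).2).1, (hχs (hφs hy).2).2⟩
  obtain ⟨hJi, hJ0⟩ := h.renormalized (G := renormPrimitive α κ ε) (g := renorm α κ ε)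
    (g' := fun s => -renormWeight α κ ε s) (C := Γ + α * ε ^ (-α) * κ⁻¹)
    (fun s hs => hasDerivAt_renormPrimitive hα hα1 hκ hε hs)
    (fun s hs => hasDerivAt_renorm hα hα1 hκ (by linarith))
    (continuousOn_renormWeight hκ hε).neg
    (fun s hs => by
      rw [abs_of_nonneg (renormPrimitive_nonneg hκ hε hs)]
      refine (renormPrimitive_le hα hα1 hκ hε hs).trans (mul_le_mul_of_nonneg_right ?_ hs)
      exact le_add_of_nonneg_right (by positivity))
    (fun s hs => (abs_renorm_le hα hα1 hκ (by linarith)).trans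
      (le_add_of_nonneg_right (by positivity)))
    (fun s hs => by
      rw [abs_neg, abs_of_pos (renormWeight_pos hα hκ (by linarith))]
      exact (renormWeight_le hα hα1 hκ hε hs).trans (le_add_of_nonneg_left hΓ0.le))
    (contDiff_mul_separated hζ hχ)
    (hasCompactSupport_mul_separated (hasCompactSupport_sq hηc) hχc)
    (hφslab.trans (slab_subset_domain n T))
  set J : Space n × ℝ → ℝ := fun y => renormPrimitive α κ ε (u y.1 y.2) * fderiv ℝ φ y (0, 1)
      - (-renormWeight α κ ε (u y.1 y.2) * inner ℝ (F y) (Du y) * φ y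
        + renorm α κ ε (u y.1 y.2) * fderiv ℝ φ y (F y, 0)) with hJ
  have hb := h.integrableOn_energyDensity (κ := κ) (L := L) hχ' hχ'1 hη hηc hT
  have hJslab : ∫ y in slab n T, J y = 0 := by
    rw [← hJ0]
    refine setIntegral_eq_integral_of_forall_compl_eq_zero fun y hy => ?_
    have hy' : y ∉ tsupport φ := fun h' => hy (hφslab h')
    change J y = 0
    have e1 : φ y = 0 := image_eq_zero_of_notMem_tsupport hy'
    have e2 : fderiv ℝ φ y = 0 := fderiv_of_notMem_tsupport (𝕜 := ℝ) hy'
    simp only [hJ, e1, e2]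
    simp
  have hae : ∀ᵐ y ∂(volume.restrict (slab n T)),
      0 ≤ dissipation α K u F Du y * renormWeight α κ ε (u y.1 y.2) * φ y ∧
      dissipation α K u F Du y * renormWeight α κ ε (u y.1 y.2) * φ y
        ≤ J y + energyDensity α κ K L χ' η u F y := by
    filter_upwards [ae_slab_of_ae_domain h.nonneg, ae_slab_of_ae_domain h.flux_le] with y hu0 hfl
    obtain ⟨D, _, _, hS, _⟩ := hfl
    have hw := renormWeight_pos (s := u y.1 y.2) (ε := ε) hα hκ (by linarith)
    have hφ0 : 0 ≤ φ y := mul_nonneg (sq_nonneg _) (hχ0 _)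
    refine ⟨mul_nonneg (mul_nonneg hS hw.le) hφ0, ?_⟩
    have hχ1 : χ y.2 ≤ 1 := (hχχ' _).trans ((le_abs_self _).trans (hχ'1 _))
    -- the three terms of the bound
    have t1 : -(renormPrimitive α κ ε (u y.1 y.2) * (η y.1 ^ 2 * deriv χ y.2))
        ≤ Γ * L * (u y.1 y.2 * η y.1 ^ 2) := by
      have g0 := renormPrimitive_nonneg hκ hε hu0 (α := α)
      have g1 := renormPrimitive_le hα hα1 hκ hε hu0
      have e0 : 0 ≤ η y.1 ^ 2 := sq_nonneg _
      -- Since the primitive is nonnegative, the rise of the time cutoff has the favourable sign and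
      -- only its decrease, at rate at most `L`, costs anything.
      calc -(renormPrimitive α κ ε (u y.1 y.2) * (η y.1 ^ 2 * deriv χ y.2))
          = renormPrimitive α κ ε (u y.1 y.2) * η y.1 ^ 2 * (-deriv χ y.2) := by ring
        _ ≤ renormPrimitive α κ ε (u y.1 y.2) * η y.1 ^ 2 * L :=
          mul_le_mul_of_nonneg_left (by linarith [hχL y.2]) (mul_nonneg g0 e0)
        _ ≤ (Γ * u y.1 y.2) * η y.1 ^ 2 * L := by gcongr
        _ = _ := by ring
    have t2 : K * u y.1 y.2 ^ (2 - α) * renormWeight α κ ε (u y.1 y.2) * φ y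
        ≤ K * κ ^ (-(2 * α)) * ((u y.1 y.2 + κ) * η y.1 ^ 2) := by
      have := rpow_mul_renormWeight_le hα hα' hκ hε hu0
      calc K * u y.1 y.2 ^ (2 - α) * renormWeight α κ ε (u y.1 y.2) * φ y
          = K * (u y.1 y.2 ^ (2 - α) * renormWeight α κ ε (u y.1 y.2)) * (η y.1 ^ 2 * χ y.2) := by
            rw [hφ]; ring
        _ ≤ K * (κ ^ (-(2 * α)) * (u y.1 y.2 + κ)) * (η y.1 ^ 2 * 1) := by
            gcongr
        _ = _ := by ring
    have t3 : renorm α κ ε (u y.1 y.2) * (χ y.2 * fderiv ℝ (fun x => η x ^ 2) y.1 (F y))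
        ≤ Γ * (‖F y‖ * (χ' y.2 * ‖fderiv ℝ (fun x => η x ^ 2) y.1‖)) := by
      have r0 := renorm_nonneg (α := α) hκ (by linarith : 0 ≤ u y.1 y.2 + ε)
      have r1 := renorm_le hα hα1 hκ (by linarith : 0 ≤ u y.1 y.2 + ε)
      have l1 : fderiv ℝ (fun x => η x ^ 2) y.1 (F y)
          ≤ ‖fderiv ℝ (fun x => η x ^ 2) y.1‖ * ‖F y‖ :=
        (Real.le_norm_self _).trans (ContinuousLinearMap.le_opNorm _ _)
      have c0 := hχ0 y.2
      calc renorm α κ ε (u y.1 y.2) * (χ y.2 * fderiv ℝ (fun x => η x ^ 2) y.1 (F y))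
          ≤ renorm α κ ε (u y.1 y.2) * (χ y.2 * (‖fderiv ℝ (fun x => η x ^ 2) y.1‖ * ‖F y‖)) := by
            gcongr
        _ ≤ Γ * (χ' y.2 * (‖fderiv ℝ (fun x => η x ^ 2) y.1‖ * ‖F y‖)) := by
            gcongr
            exact hχχ' _
        _ = _ := by ring
    have d1 : fderiv ℝ φ y (0, 1) = η y.1 ^ 2 * deriv χ y.2 := by
      rw [hφ, fderiv_mul_separated hζ hχ]; simp
    have d2 : fderiv ℝ φ y (F y, 0) = χ y.2 * fderiv ℝ (fun x => η x ^ 2) y.1 (F y) := by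
      rw [hφ, fderiv_mul_separated hζ hχ]; simp
    simp only [hJ, d1, d2, dissipation, energyDensity, ← hΓ]
    linarith [t1, t2, t3]
  calc ∫⁻ y in slab n T, ENNReal.ofReal (dissipation α K u F Du y
        * renormWeight α κ ε (u y.1 y.2) * (η y.1 ^ 2 * χ y.2))
      ≤ ∫⁻ y in slab n T, ENNReal.ofReal (J y + energyDensity α κ K L χ' η u F y) :=
        lintegral_mono_ae (hae.mono fun y hy => ENNReal.ofReal_le_ofReal hy.2)
    _ = ENNReal.ofReal (∫ y in slab n T, (J y + energyDensity α κ K L χ' η u F y)) :=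
        (ofReal_integral_eq_lintegral_ofReal (hJi.integrableOn.add hb)
          (hae.mono fun y hy => hy.1.trans hy.2)).symm
    _ = _ := by rw [integral_add hJi.integrableOn hb, hJslab, zero_add]

end ScalarSolution


/-! ### Time cutoff, and the flux estimate after removing the regularization. -/

theorem exists_bound_deriv_smoothTransition :
    ∃ L : ℝ, 0 ≤ L ∧ ∀ s, |deriv Real.smoothTransition s| ≤ L := by
  have hc : Continuous (deriv Real.smoothTransition) :=
    (Real.smoothTransition.contDiff (n := 1)).continuous_deriv (by simp)
  obtain ⟨L, hL⟩ := (isCompact_Icc (a := (0:ℝ)) (b := 1)).exists_bound_of_continuousOn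
    hc.continuousOn
  have hL0 : 0 ≤ L := (norm_nonneg _).trans (hL 0 (by simp))
  refine ⟨L, hL0, fun s => ?_⟩
  by_cases hs : s ∈ Icc (0:ℝ) 1
  · exact hL s hs
  · have : deriv Real.smoothTransition s = 0 := by
      rcases lt_or_ge s 0 with h | h
      · have : Real.smoothTransition =ᶠ[𝓝 s] fun _ => 0 := by
          filter_upwards [Iio_mem_nhds h] with t ht
          exact Real.smoothTransition.zero_of_nonpos (le_of_lt ht)
        rw [this.deriv_eq]; simp
      · have h1 : 1 < s := not_le.1 fun h1 => hs ⟨h, h1⟩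
        have : Real.smoothTransition =ᶠ[𝓝 s] fun _ => 1 := by
          filter_upwards [Ioi_mem_nhds h1] with t ht
          exact Real.smoothTransition.one_of_one_le (le_of_lt ht)
        rw [this.deriv_eq]; simp
    rw [this, abs_zero]; exact hL0

/-- A smooth cutoff in time that vanishes for `s ≤ a` and for `s ≥ T`. -/
noncomputable def timeCutoff (a T s : ℝ) : ℝ :=
  Real.smoothTransition (s / a - 1) * Real.smoothTransition (T - s)

section TimeCutoff

variable {a T : ℝ}

theorem contDiff_timeCutoff : ContDiff ℝ ∞ (timeCutoff a T) :=
  (Real.smoothTransition.contDiff.comp (by fun_prop)).mul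
    (Real.smoothTransition.contDiff.comp (by fun_prop))

theorem timeCutoff_nonneg (s : ℝ) : 0 ≤ timeCutoff a T s :=
  mul_nonneg (Real.smoothTransition.nonneg _) (Real.smoothTransition.nonneg _)

theorem timeCutoff_le (s : ℝ) : timeCutoff a T s ≤ Real.smoothTransition (T - s) :=
  mul_le_of_le_one_left (Real.smoothTransition.nonneg _) (Real.smoothTransition.le_one _)

theorem tsupport_timeCutoff (ha : 0 < a) : tsupport (timeCutoff a T) ⊆ Icc a T := by
  refine closure_minimal (fun s hs => ?_) isClosed_Icc
  have hs' : timeCutoff a T s ≠ 0 := hs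
  refine ⟨not_lt.1 fun h => hs' ?_, not_lt.1 fun h => hs' ?_⟩
  · rw [timeCutoff, Real.smoothTransition.zero_of_nonpos, zero_mul]
    rw [sub_nonpos, div_le_one ha]; exact h.le
  · rw [timeCutoff, Real.smoothTransition.zero_of_nonpos (by linarith : T - s ≤ 0), mul_zero]

/-- Uniform in `a`: the factor that becomes steep as `a → 0` is increasing and contributes a
nonnegative term. -/
theorem neg_le_deriv_timeCutoff (ha : 0 < a) {L : ℝ}
    (hL : ∀ s, |deriv Real.smoothTransition s| ≤ L) (s : ℝ) : -L ≤ deriv (timeCutoff a T) s := by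
  have hd : ∀ x, HasDerivAt Real.smoothTransition (deriv Real.smoothTransition x) x := fun x =>
    ((Real.smoothTransition.contDiff (n := 1)).differentiable (by simp) x).hasDerivAt
  have h1 : HasDerivAt (fun s => Real.smoothTransition (s / a - 1))
      (deriv Real.smoothTransition (s / a - 1) * (1 / a)) s :=
    (hd _).comp s (((hasDerivAt_id s).div_const a).sub_const 1)
  have h2 : HasDerivAt (fun s => Real.smoothTransition (T - s))
      (deriv Real.smoothTransition (T - s) * (-1)) s :=
    (hd _).comp s ((hasDerivAt_id s).const_sub T)
  rw [show deriv (timeCutoff a T) s = _ from (h1.mul h2).deriv]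
  have n1 : 0 ≤ deriv Real.smoothTransition (s / a - 1) :=
    Real.smoothTransition.monotone.deriv_nonneg
  have n2 := Real.smoothTransition.monotone.deriv_nonneg (x := T - s)
  have n3 := Real.smoothTransition.nonneg (T - s)
  have n4 := Real.smoothTransition.nonneg (s / a - 1)
  have n5 := Real.smoothTransition.le_one (s / a - 1)
  have n6 := (le_abs_self _).trans (hL (T - s))
  have n7 : 0 ≤ deriv Real.smoothTransition (s / a - 1) * (1 / a) *
      Real.smoothTransition (T - s) := by positivity
  have n8 : Real.smoothTransition (s / a - 1) * deriv Real.smoothTransition (T - s)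
      ≤ 1 * L := mul_le_mul n5 n6 n2 zero_le_one
  linarith

theorem tendsto_timeCutoff {e : ℕ → ℝ} (he0 : ∀ j, 0 < e j) (he : Tendsto e atTop (𝓝 0)) {s : ℝ}
    (hs : 0 < s) :
    Tendsto (fun j => timeCutoff (e j) T s) atTop (𝓝 (Real.smoothTransition (T - s))) := by
  refine tendsto_const_nhds.congr' ?_
  filter_upwards [he.eventually (Iio_mem_nhds (half_pos hs))] with j hj
  suffices h1 : 1 ≤ s / e j - 1 by
    rw [timeCutoff, Real.smoothTransition.one_of_one_le h1, one_mul]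
  rw [le_sub_iff_add_le, le_div_iff₀ (he0 j)]
  have : e j < s / 2 := hj
  linarith

end TimeCutoff

/-- Young's inequality with parameter `θ`, compared after squaring so that `√(p q)` does not appear.
It is applied with `p` the weighted dissipation and `q` a multiple of `u + κ`. -/
theorem two_mul_mul_le_of_sq_le {f p q e d θ : ℝ} (hq : 0 ≤ q) (hp : 0 ≤ p) (hθ : 0 < θ) (h : f ^ 2 ≤ p * q) :
    f * (2 * e * d) ≤ θ * (p * e ^ 2) + θ⁻¹ * (q * d ^ 2) := by
  refine le_of_sq_le_sq ?_ (by positivity)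
  have h1 : (f * (2 * e * d)) ^ 2 ≤ 4 * (θ * (p * e ^ 2)) * (θ⁻¹ * (q * d ^ 2)) := by
    calc (f * (2 * e * d)) ^ 2 = f ^ 2 * (4 * e ^ 2 * d ^ 2) := by ring
      _ ≤ p * q * (4 * e ^ 2 * d ^ 2) := mul_le_mul_of_nonneg_right h (by positivity)
      _ = (θ * θ⁻¹) * (p * q * (4 * e ^ 2 * d ^ 2)) := by rw [mul_inv_cancel₀ hθ.ne', one_mul]
      _ = _ := by ring
  nlinarith [sq_nonneg (θ * (p * e ^ 2) - θ⁻¹ * (q * d ^ 2))]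

namespace ScalarSolution

variable {n : ℕ} {α K : ℝ} {u0 : Space n → ℝ} {u : Space n → ℝ → ℝ}
  {F Du : Space n × ℝ → Space n}

/-- The weighted flux through the support of the gradient of a cutoff function is controlled by
the dissipation and a lower order term. -/
theorem integral_flux_le (h : ScalarSolution α K u0 u F Du) (hα : 0 < α)
    (hα' : α < 1 / 2) (hK : 0 ≤ K) {κ L T θ : ℝ} (hκ : 0 < κ)
    (hT : 0 < T) (hL0 : 0 ≤ L) (hL : ∀ s, |deriv Real.smoothTransition s| ≤ L) (hθ : 0 < θ)
    {η : Space n → ℝ} (hη : ContDiff ℝ ∞ η) (hηc : HasCompactSupport η) (hη0 : ∀ x, 0 ≤ η x) :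
    ∫ y in slab n T, ‖F y‖ * (Real.smoothTransition (T - y.2)
        * ‖fderiv ℝ (fun x => η x ^ 2) y.1‖)
      ≤ θ * (∫ y in slab n T,
          energyDensity α κ K L (fun s => Real.smoothTransition (T - s)) η u F y)
        + θ⁻¹ * (4 * K / α * ∫ y in slab n T,
          (u y.1 y.2 + κ) * (Real.smoothTransition (T - y.2) * ‖fderiv ℝ η y.1‖ ^ 2)) := by
  have hα1 : α < 1 := by linarith
  set χ' : ℝ → ℝ := fun s => Real.smoothTransition (T - s) with hχ'
  have hχ'c : Continuous χ' := Real.smoothTransition.continuous.comp (by fun_prop)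
  have hχ'0 : ∀ s, 0 ≤ χ' s := fun s => Real.smoothTransition.nonneg _
  have hχ'1 : ∀ s, |χ' s| ≤ 1 := fun s => by
    rw [abs_of_nonneg (hχ'0 s)]; exact Real.smoothTransition.le_one _
  -- One sequence serves both as the shift `ε` of the weight and as the opening time `a` of the
  -- cutoff.
  set e : ℕ → ℝ := fun j => 1 / ((j : ℝ) + 1) with he
  have he0 : ∀ j, 0 < e j := fun j => by positivity
  have het : Tendsto e atTop (𝓝 0) := tendsto_one_div_add_atTop_nhds_zero_nat
  set S := dissipation α K u F Du with hS
  set X : ℕ → Space n × ℝ → ENNReal := fun j y => ENNReal.ofReal (S y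
    * renormWeight α κ (e j) (u y.1 y.2) * (η y.1 ^ 2 * timeCutoff (e j) T y.2)) with hX
  set B : ℝ := ∫ y in slab n T, energyDensity α κ K L χ' η u F y with hB
  have hXle : ∀ j, ∫⁻ y in slab n T, X j y ≤ ENNReal.ofReal B := fun j =>
    h.lintegral_dissipation_le hα hα' hK hκ (he0 j) (he0 j) hT hL0 contDiff_timeCutoff
      (tsupport_timeCutoff (he0 j)) timeCutoff_nonneg (neg_le_deriv_timeCutoff (he0 j) hL) hχ'c
      timeCutoff_le hχ'1 hη hηc
  -- measurability
  have mu : AEStronglyMeasurable (fun y : Space n × ℝ => u y.1 y.2)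
      (volume.restrict (slab n T)) :=
    (h.weakGradient.1.aestronglyMeasurable).mono_measure
      (Measure.restrict_mono (slab_subset_domain n T) le_rfl)
  have mF : AEStronglyMeasurable F (volume.restrict (slab n T)) := (h.flux_sq T hT).1
  have mD : AEStronglyMeasurable Du (volume.restrict (slab n T)) :=
    (h.weakGradient.2.1.aestronglyMeasurable).mono_measure
      (Measure.restrict_mono (slab_subset_domain n T) le_rfl)
  have mS : AEMeasurable S (volume.restrict (slab n T)) :=
    (mF.inner mD).aemeasurable.add ((mu.aemeasurable.pow_const _).const_mul _)
  have mX : ∀ j, AEMeasurable (X j) (volume.restrict (slab n T)) := fun j => by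
    have m1 : Measurable fun y : Space n × ℝ => η y.1 ^ 2 * timeCutoff (e j) T y.2 :=
      (((hη.continuous.comp continuous_fst).pow 2).mul
        (contDiff_timeCutoff.continuous.comp continuous_snd)).measurable
    exact ((mS.mul (measurable_renormWeight.comp_aemeasurable mu.aemeasurable)).mul
      m1.aemeasurable).ennreal_ofReal
  -- Fatou's lemma; `B` does not depend on `j`.
  have hlim : ∫⁻ y in slab n T, liminf (fun j => X j y) atTop ≤ ENNReal.ofReal B :=
    (lintegral_liminf_le' mX).trans (liminf_le_of_le (by isBoundedDefault)
      fun b hb => by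
        obtain ⟨j, hj⟩ := hb.exists
        exact hj.trans (hXle j))
  -- integrability of both sides
  have hQi : IntegrableOn (fun y : Space n × ℝ => ‖F y‖ * (χ' y.2
      * ‖fderiv ℝ (fun x => η x ^ 2) y.1‖)) (slab n T) :=
    (h.integrableOn_mul_spatial (continuous_fderiv_sq hη)
      (hasCompactSupport_fderiv_sq hηc) hχ'c hχ'1 T).2.2 hT
  have hηd : Continuous fun x => ‖fderiv ℝ η x‖ ^ 2 :=
    ((hη.continuous_fderiv (by simp)).norm).pow 2
  have hηdc : HasCompactSupport fun x => ‖fderiv ℝ η x‖ ^ 2 := by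
    simp_rw [sq]
    exact ((hηc.fderiv (𝕜 := ℝ)).norm).mul_left
  have hZi : IntegrableOn (fun y : Space n × ℝ => (u y.1 y.2 + κ) *
      (χ' y.2 * ‖fderiv ℝ η y.1‖ ^ 2)) (slab n T) := by
    have := h.integrableOn_mul_spatial hηd hηdc hχ'c hχ'1 T
    simp_rw [add_mul]
    exact this.1.add (this.2.1.const_mul κ)
  have hpt : ∀ᵐ y ∂(volume.restrict (slab n T)),
      ENNReal.ofReal (‖F y‖ * (χ' y.2 * ‖fderiv ℝ (fun x => η x ^ 2) y.1‖))
        ≤ ENNReal.ofReal θ * liminf (fun j => X j y) atTop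
          + ENNReal.ofReal (θ⁻¹ * (4 * K / α * ((u y.1 y.2 + κ) *
            (χ' y.2 * ‖fderiv ℝ η y.1‖ ^ 2)))) := by
    filter_upwards [ae_slab_of_ae_domain h.nonneg, ae_slab_of_ae_domain h.flux_le,
      ae_restrict_mem (measurableSet_slab n T)] with y hu0 hfl hy
    obtain ⟨D, hD0, hDK, hS0, hF2⟩ := hfl
    change 0 ≤ S y at hS0
    change ‖F y‖ ^ 2 ≤ D * S y at hF2
    have hχt := tendsto_timeCutoff (T := T) he0 het hy.2.1
    rw [norm_fderiv_sq hη, abs_of_nonneg (hη0 _)]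
    -- At `u = 0` either `S` or the cutoff vanishes, and then so does the left side, or `X j y → ∞`
    -- and the right side is infinite. At `u > 0` the weights converge and Young's inequality
    -- applies.
    rcases hu0.eq_or_lt with hu | hu
    · by_cases hz : S y * (η y.1 ^ 2 * χ' y.2) = 0
      · have : ‖F y‖ * (χ' y.2 * (2 * η y.1 * ‖fderiv ℝ η y.1‖)) = 0 := by
          rcases mul_eq_zero.1 hz with h1 | h1
          · rw [h1, mul_zero] at hF2
            have : ‖F y‖ = 0 := by
              have := le_antisymm hF2 (sq_nonneg _)
              exact pow_eq_zero_iff (two_ne_zero) |>.1 this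
            rw [this, zero_mul]
          · rcases mul_eq_zero.1 h1 with h2 | h2
            · rw [pow_eq_zero_iff (two_ne_zero)] at h2
              rw [h2]; ring
            · rw [h2]; ring
        rw [this, ENNReal.ofReal_zero]
        exact zero_le
      · have hpos : 0 < S y * (η y.1 ^ 2 * χ' y.2) :=
          lt_of_le_of_ne (mul_nonneg hS0 (mul_nonneg (sq_nonneg _) (hχ'0 _))) (Ne.symm hz)
        have ht : Tendsto (fun j => X j y) atTop (𝓝 ⊤) := by
          refine ENNReal.tendsto_ofReal_atTop.comp ?_
          have h1 := tendsto_renormWeight_zero hα hα1 hκ he0 het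
          have h2 : Tendsto (fun j => S y * (η y.1 ^ 2 * timeCutoff (e j) T y.2)) atTop
              (𝓝 (S y * (η y.1 ^ 2 * χ' y.2))) := (hχt.const_mul _).const_mul _
          refine (h1.atTop_mul_pos hpos h2).congr fun j => ?_
          rw [← hu]; ring
        rw [ht.liminf_eq, ENNReal.mul_top (by simpa using hθ)]
        simp
    · have ht : Tendsto (fun j => X j y) atTop (𝓝 (ENNReal.ofReal (S y *
          renormWeight α κ 0 (u y.1 y.2) * (η y.1 ^ 2 * χ' y.2)))) :=
        ENNReal.tendsto_ofReal (((tendsto_renormWeight hκ hu het).const_mul _).mul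
          (hχt.const_mul _))
      have hw : 0 < renormWeight α κ 0 (u y.1 y.2) := renormWeight_pos hα hκ (by linarith)
      rw [ht.liminf_eq, ← ENNReal.ofReal_mul hθ.le, ← ENNReal.ofReal_add]
      · refine ENNReal.ofReal_le_ofReal ?_
        have h1 : ‖F y‖ ^ 2 ≤ (S y * renormWeight α κ 0 (u y.1 y.2)) *
            (4 * K / α * (u y.1 y.2 + κ)) := by
          have h2 := one_le_renormWeight_mul hα hα' hκ hu
          calc ‖F y‖ ^ 2 ≤ D * S y * 1 := by rw [mul_one]; exact hF2
            _ ≤ D * S y * (4 / α * u y.1 y.2 ^ α * (u y.1 y.2 + κ) *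
                renormWeight α κ 0 (u y.1 y.2)) := by gcongr
            _ = (D * u y.1 y.2 ^ α) * (S y * (4 / α * (u y.1 y.2 + κ) *
                renormWeight α κ 0 (u y.1 y.2))) := by ring
            _ ≤ K * (S y * (4 / α * (u y.1 y.2 + κ) *
                renormWeight α κ 0 (u y.1 y.2))) := by gcongr
            _ = _ := by ring
        have h3 := two_mul_mul_le_of_sq_le (e := η y.1) (d := ‖fderiv ℝ η y.1‖) (by positivity)
          (mul_nonneg hS0 hw.le) hθ h1
        have h4 := mul_le_mul_of_nonneg_left h3 (hχ'0 y.2)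
        linarith [h4]
      · exact mul_nonneg hθ.le (mul_nonneg (mul_nonneg hS0 hw.le)
          (mul_nonneg (sq_nonneg _) (hχ'0 _)))
      · have := hχ'0 y.2
        positivity
  have hB0 : 0 ≤ B := by
    refine setIntegral_nonneg_of_ae_restrict ?_
    filter_upwards [ae_slab_of_ae_domain h.nonneg] with y hy
    have := hχ'0 y.2
    simp only [energyDensity, Pi.zero_apply]
    positivity
  have hZ0 : ∀ᵐ y ∂(volume.restrict (slab n T)), 0 ≤ θ⁻¹ * (4 * K / α * ((u y.1 y.2 + κ) *
      (χ' y.2 * ‖fderiv ℝ η y.1‖ ^ 2))) := by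
    filter_upwards [ae_slab_of_ae_domain h.nonneg] with y hy
    have := hχ'0 y.2
    positivity
  have hQ0 : ∀ᵐ y ∂(volume.restrict (slab n T)), 0 ≤ ‖F y‖ * (χ' y.2
      * ‖fderiv ℝ (fun x => η x ^ 2) y.1‖) := Eventually.of_forall fun y => by
    have := hχ'0 y.2
    positivity
  have hZi' := (hZi.const_mul (4 * K / α)).const_mul θ⁻¹
  have hfin := lintegral_mono_ae hpt
  rw [lintegral_add_right' _ hZi'.aestronglyMeasurable.aemeasurable.ennreal_ofReal,
    lintegral_const_mul' _ _ ENNReal.ofReal_ne_top,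
    ← ofReal_integral_eq_lintegral_ofReal hQi hQ0,
    ← ofReal_integral_eq_lintegral_ofReal hZi' hZ0] at hfin
  have h5 := hfin.trans (add_le_add_left (mul_le_mul_right hlim (ENNReal.ofReal θ)) _)
  rw [← ENNReal.ofReal_mul hθ.le, ← ENNReal.ofReal_add (mul_nonneg hθ.le hB0)
    (integral_nonneg_of_ae hZ0), ENNReal.ofReal_le_ofReal_iff (add_nonneg
      (mul_nonneg hθ.le hB0) (integral_nonneg_of_ae hZ0)), integral_const_mul,
      integral_const_mul] at h5
  exact h5

end ScalarSolution


/-! ### Spatial cutoffs and the inequalities between flux and mass. -/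

/-- A smooth cutoff function of the ball of radius `R`, supported in the ball of radius `2R`. -/
noncomputable def spaceCutoff (n : ℕ) (R : ℝ) (x : Space n) : ℝ :=
  (⟨1, 2, one_pos, one_lt_two⟩ : ContDiffBump (0 : Space n)) (R⁻¹ • x)

section SpaceCutoff

variable {n : ℕ} {R : ℝ}

theorem contDiff_spaceCutoff : ContDiff ℝ ∞ (spaceCutoff n R) :=
  (ContDiffBump.contDiff _).comp (contDiff_const_smul _)

theorem spaceCutoff_nonneg (x : Space n) : 0 ≤ spaceCutoff n R x := ContDiffBump.nonneg _

theorem spaceCutoff_le_one (x : Space n) : spaceCutoff n R x ≤ 1 := ContDiffBump.le_one _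

theorem spaceCutoff_sq_le_one (x : Space n) : spaceCutoff n R x ^ 2 ≤ 1 :=
  pow_le_one₀ (spaceCutoff_nonneg x) (spaceCutoff_le_one x)

theorem spaceCutoff_eq_one (hR : 0 < R) {x : Space n} (hx : ‖x‖ ≤ R) : spaceCutoff n R x = 1 := by
  refine ContDiffBump.one_of_mem_closedBall _ ?_
  rw [mem_closedBall_zero_iff, norm_smul, norm_inv, Real.norm_of_nonneg hR.le]
  rw [inv_mul_le_iff₀ hR]; simpa using hx

theorem tsupport_spaceCutoff (hR : 0 < R) :
    tsupport (spaceCutoff n R) ⊆ Metric.closedBall 0 (2 * R) := by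
  refine closure_minimal (fun x hx => ?_) Metric.isClosed_closedBall
  rw [mem_closedBall_zero_iff]
  by_contra h
  refine hx (ContDiffBump.zero_of_le_dist _ ?_)
  rw [dist_zero_right, norm_smul, norm_inv, Real.norm_of_nonneg hR.le, ← div_eq_inv_mul,
    le_div_iff₀ hR]
  exact (not_le.1 h).le

theorem hasCompactSupport_spaceCutoff (hR : 0 < R) : HasCompactSupport (spaceCutoff n R) :=
  (isCompact_closedBall _ _).of_isClosed_subset (isClosed_tsupport _) (tsupport_spaceCutoff hR)

theorem exists_norm_fderiv_spaceCutoff_le (n : ℕ) :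
    ∃ C : ℝ, 0 ≤ C ∧ ∀ R, 0 < R → ∀ x, ‖fderiv ℝ (spaceCutoff n R) x‖ ≤ C / R := by
  set ψ : ContDiffBump (0 : Space n) := ⟨1, 2, one_pos, one_lt_two⟩ with hψ
  obtain ⟨C, hC⟩ := (ψ.hasCompactSupport.fderiv (𝕜 := ℝ)).exists_bound_of_continuous
    ((ψ.contDiff (n := 1)).continuous_fderiv (by simp))
  refine ⟨C, (norm_nonneg _).trans (hC 0), fun R hR x => ?_⟩
  have h1 : HasFDerivAt (spaceCutoff n R) ((fderiv ℝ ψ (R⁻¹ • x)).comp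
      (R⁻¹ • ContinuousLinearMap.id ℝ (Space n))) x :=
    ((ψ.contDiff (n := 1)).differentiable (by simp) _).hasFDerivAt.comp x
      ((hasFDerivAt_id x).const_smul R⁻¹)
  rw [h1.fderiv, ContinuousLinearMap.comp_smul, ContinuousLinearMap.comp_id, norm_smul, norm_inv,
    Real.norm_of_nonneg hR.le, ← div_eq_inv_mul]
  gcongr
  exact hC _

end SpaceCutoff

/-- The flux through the shell where the cutoff function of radius `R` varies. -/
noncomputable def shellFlux {n : ℕ} (F : Space n × ℝ → Space n) (T R : ℝ) : ℝ :=
  ∫ y in slab n T, ‖F y‖ * ‖fderiv ℝ (fun x => spaceCutoff n R x ^ 2) y.1‖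

/-- The space-time mass in the ball of radius `R`. -/
noncomputable def localMass {n : ℕ} (u : Space n → ℝ → ℝ) (T R : ℝ) : ℝ :=
  ∫ y in (Metric.closedBall (0 : Space n) R) ×ˢ Ioc 0 T, u y.1 y.2

theorem volume_real_cylinder (n : ℕ) {R T : ℝ} (hR : 0 ≤ R) (hT : 0 ≤ T) :
    (volume : Measure (Space n × ℝ)).real (Metric.closedBall (0 : Space n) R ×ˢ Ioc 0 T)
      = R ^ n * (volume.real (Metric.ball (0 : Space n) 1) * T) := by
  rw [Measure.volume_eq_prod, measureReal_prod_prod, measureReal_def, Measure.addHaar_closedBall _ _ hR]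
  simp [hT, measureReal_def, ENNReal.toReal_mul, hR, mul_assoc]

/-- With `θ = 1 / (2 R Γ)` the flux on the right has coefficient `1 / (2 R) ≤ 1 / 2` and is
absorbed, while every other term is of order `Γ Y / R`. -/
theorem le_of_absorption {q Γ L K R Y P α : ℝ} (hα : 0 < α) (hL : 0 ≤ L)
    (hR : 1 ≤ R) (hΓ : 1 ≤ Γ) (hY : 0 ≤ Y) (hq : 0 ≤ q)
    (h : q ≤ 1 / (2 * R * Γ) * (Γ * L * Y + K * Γ ^ 2 * Y + Γ * q)
      + (1 / (2 * R * Γ))⁻¹ * (4 * K / α * ((P / R) ^ 2 * Y))) :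
    q ≤ Γ / R * ((L + K + 16 * K * P ^ 2 / α) * Y) := by
  have hR0 : 0 < R := by linarith
  have hΓ0 : 0 < Γ := by linarith
  have e1 : 1 / (2 * R * Γ) * (Γ * L * Y + K * Γ ^ 2 * Y + Γ * q)
      = 1 / 2 * (1 / R * ((L + K * Γ) * Y)) + 1 / 2 * (1 / R * q) := by
    field_simp
  have e2 : (1 / (2 * R * Γ))⁻¹ * (4 * K / α * ((P / R) ^ 2 * Y))
      = 1 / 2 * (Γ / R * (16 * K * P ^ 2 / α * Y)) := by
    field_simp; ring
  have h3 : 1 / R * q ≤ q := mul_le_of_le_one_left hq ((div_le_one hR0).2 hR)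
  have h4 : L + K * Γ ≤ Γ * (L + K) := by
    have := mul_le_mul_of_nonneg_right hΓ hL
    linarith
  have h5 : 1 / R * ((L + K * Γ) * Y) ≤ Γ / R * ((L + K) * Y) := by
    calc 1 / R * ((L + K * Γ) * Y) ≤ 1 / R * (Γ * (L + K) * Y) := by gcongr
      _ = _ := by ring
  rw [e1, e2] at h
  linarith

namespace ScalarSolution

variable {n : ℕ} {α K : ℝ} {u0 : Space n → ℝ} {u : Space n → ℝ → ℝ}
  {F Du : Space n × ℝ → Space n}

theorem integrableOn_shellFlux (h : ScalarSolution α K u0 u F Du) {T R : ℝ} (hT : 0 < T)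
    (hR : 0 < R) : IntegrableOn (fun y => ‖F y‖ *
      ‖fderiv ℝ (fun x => spaceCutoff n R x ^ 2) y.1‖) (slab n T) := by
  have := (h.integrableOn_mul_spatial (continuous_fderiv_sq (contDiff_spaceCutoff (R := R)))
    (hasCompactSupport_fderiv_sq (hasCompactSupport_spaceCutoff hR)) (χ := fun _ => 1)
    continuous_const (M := 1) (by simp) T).2.2 hT
  simpa only [one_mul] using this

theorem shellFlux_mono (h : ScalarSolution α K u0 u F Du) {t T R : ℝ} (ht : 0 < t) (htT : t ≤ T)
    (hR : 0 < R) : shellFlux F t R ≤ shellFlux F T R :=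
  setIntegral_mono_set (h.integrableOn_shellFlux (ht.trans_le htT) hR)
    (Eventually.of_forall fun _ => mul_nonneg (norm_nonneg _) (norm_nonneg _))
    (LE.le.eventuallyLE (prod_mono_right (Ioc_subset_Ioc_right htT)))

/-- The change of a local mass is the flux through the cutoff. -/
theorem integral_slice_sub (h : ScalarSolution α K u0 u F Du) {ζ : Space n → ℝ}
    (hζ : ContDiff ℝ ∞ ζ) (hζc : HasCompactSupport ζ) {t : ℝ} (ht : 0 < t) :
    (∫ x, u x t * ζ x) - ∫ x, u0 x * ζ x = -∫ y in slab n t, fderiv ℝ ζ y.1 (F y) := by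
  -- A function of `x` alone lacks compact support in time; a factor equal to one near `[0, t]`
  -- repairs this without changing the weak form.
  set χ : ContDiffBump (0 : ℝ) := ⟨t + 1, t + 2, by linarith, by linarith⟩ with hχ
  have hχ1 : ∀ s, |s| < t + 1 → χ s = 1 := fun s hs =>
    χ.one_of_mem_closedBall (by rw [mem_closedBall_zero_iff]; exact hs.le)
  have hχd : ∀ s, |s| < t + 1 → deriv χ s = 0 := fun s hs => by
    have : (χ : ℝ → ℝ) =ᶠ[𝓝 s] fun _ => 1 := by
      filter_upwards [(isOpen_lt continuous_abs continuous_const).mem_nhds hs] with r hr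
        using hχ1 r hr
    rw [this.deriv_eq]; simp
  have key := h.weak_form t ht (fun y => ζ y.1 * χ y.2)
    (contDiff_mul_separated hζ χ.contDiff) (hasCompactSupport_mul_separated hζc χ.hasCompactSupport)
  simp only at key
  rw [hχ1 t (by rw [abs_of_pos ht]; linarith), hχ1 0 (by rw [abs_zero]; linarith)] at key
  simp only [mul_one] at key
  rw [key, ← integral_neg]
  refine setIntegral_congr_fun (measurableSet_slab n t) fun y hy => ?_
  have hy2 : |y.2| < t + 1 := by
    rw [abs_of_pos hy.2.1]; linarith [hy.2.2]
  simp only [fderiv_mul_separated hζ χ.contDiff, hχ1 _ hy2, hχd _ hy2]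
  simp

theorem abs_integral_slice_sub_le (h : ScalarSolution α K u0 u F Du) {t T R : ℝ} (ht : 0 < t)
    (htT : t ≤ T) (hR : 0 < R) :
    |(∫ x, u x t * spaceCutoff n R x ^ 2) - ∫ x, u0 x * spaceCutoff n R x ^ 2|
      ≤ shellFlux F T R := by
  rw [h.integral_slice_sub (contDiff_spaceCutoff.pow 2)
    (hasCompactSupport_sq (hasCompactSupport_spaceCutoff hR)) ht, abs_neg, ← Real.norm_eq_abs]
  refine le_trans ?_ (h.shellFlux_mono ht htT hR)
  refine norm_integral_le_of_norm_le (h.integrableOn_shellFlux ht hR)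
    (Eventually.of_forall fun y => ?_)
  rw [mul_comm]
  exact (fderiv ℝ (fun x => spaceCutoff n R x ^ 2) y.1).le_opNorm (F y)

theorem integral_slice_le (h : ScalarSolution α K u0 u F Du) (hu0 : Integrable u0) {t T R : ℝ}
    (ht : 0 < t) (htT : t ≤ T) (hR : 0 < R) :
    ∫ x, u x t * spaceCutoff n R x ^ 2 ≤ (∫ x, |u0 x|) + shellFlux F T R := by
  have h1 := (abs_le.1 (h.abs_integral_slice_sub_le ht htT hR)).2
  have h2 : ∫ x, u0 x * spaceCutoff n R x ^ 2 ≤ ∫ x, |u0 x| := by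
    refine (Real.le_norm_self _).trans (norm_integral_le_of_norm_le hu0.abs
      (Eventually.of_forall fun x => ?_))
    rw [norm_mul, Real.norm_eq_abs, Real.norm_of_nonneg (sq_nonneg _)]
    exact mul_le_of_le_one_right (abs_nonneg _) (spaceCutoff_sq_le_one x)
  linarith

/-- The half of the bootstrap that bounds mass by flux: `integral_slice_le` integrated over time by
Fubini's theorem. -/
theorem localMass_le (h : ScalarSolution α K u0 u F Du) (hu0 : Integrable u0) {T R : ℝ}
    (hT : 0 < T) (hR : 0 < R) :
    localMass u T R ≤ T * ((∫ x, |u0 x|) + shellFlux F T R) := by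
  have hi : IntegrableOn (fun y : Space n × ℝ => u y.1 y.2 * spaceCutoff n R y.1 ^ 2)
      (slab n T) := by
    have := (h.integrableOn_mul_spatial (f := fun x => spaceCutoff n R x ^ 2)
      (contDiff_spaceCutoff.continuous.pow 2)
      (hasCompactSupport_sq (hasCompactSupport_spaceCutoff hR)) (χ := fun _ => 1)
      continuous_const (M := 1) (by simp) T).1
    simpa only [one_mul] using this
  have hsub : Metric.closedBall (0 : Space n) R ×ˢ Ioc 0 T ⊆ slab n T :=
    prod_mono_left (subset_univ _)
  have hm : MeasurableSet (Metric.closedBall (0 : Space n) R ×ˢ Ioc 0 T) :=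
    Metric.isClosed_closedBall.measurableSet.prod measurableSet_Ioc
  have e1 : localMass u T R = ∫ y in Metric.closedBall (0 : Space n) R ×ˢ Ioc 0 T,
      u y.1 y.2 * spaceCutoff n R y.1 ^ 2 :=
    setIntegral_congr_fun hm fun y hy => by
      have := spaceCutoff_eq_one hR (mem_closedBall_zero_iff.1 hy.1)
      simp [this]
  have e2 : localMass u T R ≤ ∫ y in slab n T, u y.1 y.2 * spaceCutoff n R y.1 ^ 2 := by
    rw [e1]
    refine setIntegral_mono_set hi ?_ (LE.le.eventuallyLE hsub)
    filter_upwards [ae_slab_of_ae_domain h.nonneg] with y hy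
    exact mul_nonneg hy (sq_nonneg _)
  refine e2.trans ?_
  have hv : (volume : Measure (Space n × ℝ)).restrict (slab n T)
      = (volume : Measure (Space n)).prod (volume.restrict (Ioc 0 T)) := by
    rw [slab, Measure.volume_eq_prod, ← Measure.prod_restrict, Measure.restrict_univ]
  unfold IntegrableOn at hi
  rw [hv] at hi ⊢
  rw [integral_prod_symm _ hi]
  calc ∫ s in Ioc 0 T, ∫ x, u x s * spaceCutoff n R x ^ 2
      ≤ ∫ s in Ioc 0 T, ((∫ x, |u0 x|) + shellFlux F T R) := by
        refine setIntegral_mono_on hi.integral_prod_right (integrableOn_const (by simp))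
          measurableSet_Ioc fun s hs => h.integral_slice_le hu0 hs.1 hs.2 hR
    _ = _ := by simp [hT.le]

/-- Comparison of an integral over the slab with the mass in a cylinder. -/
theorem integral_slab_le (h : ScalarSolution α K u0 u F Du) {κ T R M : ℝ} (hT : 0 ≤ T)
    (hR : 0 ≤ R) {f : Space n × ℝ → ℝ}
    (hf : IntegrableOn f (slab n T)) (h0 : ∀ y, y.1 ∉ Metric.closedBall (0 : Space n) R → f y = 0)
    (hle : ∀ y, 0 ≤ u y.1 y.2 → f y ≤ M * (u y.1 y.2 + κ)) :
    ∫ y in slab n T, f y ≤ M * (localMass u T R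
      + κ * (R ^ n * (volume.real (Metric.ball (0 : Space n) 1) * T))) := by
  have hB := isCompact_closedBall (0 : Space n) R
  have hsub : Metric.closedBall (0 : Space n) R ×ˢ Ioc 0 T ⊆ slab n T :=
    prod_mono_left (subset_univ _)
  rw [setIntegral_eq_of_subset_of_forall_sdiff_eq_zero (measurableSet_slab n T) hsub
    fun y hy => h0 y fun hy' => hy.2 ⟨hy', hy.1.2⟩]
  have i1 := h.integrableOn_prod hB T
  have i2 : IntegrableOn (fun _ : Space n × ℝ => κ)
      (Metric.closedBall (0 : Space n) R ×ˢ Ioc 0 T) := by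
    exact ((integrableOn_one hB T).const_mul κ).congr (Eventually.of_forall fun _ => mul_one κ)
  calc ∫ y in Metric.closedBall (0 : Space n) R ×ˢ Ioc 0 T, f y
      ≤ ∫ y in Metric.closedBall (0 : Space n) R ×ˢ Ioc 0 T, M * (u y.1 y.2 + κ) := by
        refine setIntegral_mono_ae_restrict (hf.mono_set hsub) ((i1.add i2).const_mul M) ?_
        filter_upwards [ae_restrict_of_ae_restrict_of_subset hsub
          (ae_slab_of_ae_domain h.nonneg)] with y hy using hle y hy
    _ = _ := by
        rw [integral_const_mul, integral_add i1 i2, setIntegral_const,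
          volume_real_cylinder n hR hT, localMass, smul_eq_mul]
        ring

/-- The flux through a distant shell is controlled by the mass in a larger ball. -/
theorem exists_shellFlux_le (h : ScalarSolution α K u0 u F Du) (hα : 0 < α)
    (hα' : α < 1 / 2) (hK : 0 ≤ K) {T : ℝ} (hT : 0 < T) :
    ∃ C : ℝ, 0 ≤ C ∧ ∀ R : ℝ, 1 ≤ R →
      shellFlux F T R ≤ C * R ^ (n * α - 1) * (1 + localMass u (T + 1) (2 * R)) := by
  obtain ⟨L, hL0, hL⟩ := exists_bound_deriv_smoothTransition
  obtain ⟨P, hP0, hP⟩ := exists_norm_fderiv_spaceCutoff_le n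
  set v₀ := 2 ^ n * (volume.real (Metric.ball (0 : Space n) 1) * (T + 1)) with hv₀
  have hv0 : 0 ≤ v₀ := by positivity
  set C₀ := (L + K) + 16 * K * P ^ 2 / α with hC₀
  have hC₀0 : 0 ≤ C₀ := by positivity
  refine ⟨C₀ * (1 + v₀), by positivity, fun R hR => ?_⟩
  have hR0 : 0 < R := by linarith
  have hT1 : 0 < T + 1 := by linarith
  -- This choice keeps `κ` times the volume of the ball bounded in `R`, and costs the factor `Γ =
  -- R^(nα)`.
  set κ : ℝ := R ^ (-(n:ℝ)) with hκ
  have hκ0 : 0 < κ := by positivity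
  set Γ : ℝ := κ ^ (-α) with hΓ
  have hΓR : Γ = R ^ (n * α) := by
    rw [hΓ, hκ, ← Real.rpow_mul hR0.le]; congr 1; ring
  have hΓ0 : 0 < Γ := by positivity
  have hΓ1 : 1 ≤ Γ := by
    rw [hΓR]; exact Real.one_le_rpow hR (by positivity)
  have hΓ2 : κ ^ (-(2 * α)) = Γ ^ 2 := by
    rw [hΓ, ← Real.rpow_natCast, ← Real.rpow_mul hκ0.le]; congr 1; push_cast; ring
  set η := spaceCutoff n R with hη
  have hηs : ContDiff ℝ ∞ η := contDiff_spaceCutoff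
  have hηc : HasCompactSupport η := hasCompactSupport_spaceCutoff hR0
  -- The cutoff equals one up to time `T` and falls to zero by `T + 1`; hence the later time on the
  -- right side.
  set χ : ℝ → ℝ := fun s => Real.smoothTransition (T + 1 - s) with hχ
  have hχc : Continuous χ := Real.smoothTransition.continuous.comp (by fun_prop)
  have hχ0 : ∀ s, 0 ≤ χ s := fun s => Real.smoothTransition.nonneg _
  have hχ1 : ∀ s, χ s ≤ 1 := fun s => Real.smoothTransition.le_one _
  have hχa : ∀ s, |χ s| ≤ 1 := fun s => by rw [abs_of_nonneg (hχ0 s)]; exact hχ1 s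
  have hout : ∀ x : Space n, x ∉ Metric.closedBall 0 (2 * R) → η x = 0 ∧ fderiv ℝ η x = 0 :=
    fun x hx => ⟨image_eq_zero_of_notMem_tsupport fun h' => hx (tsupport_spaceCutoff hR0 h'),
      fderiv_of_notMem_tsupport (𝕜 := ℝ) fun h' => hx (tsupport_spaceCutoff hR0 h')⟩
  set Y : ℝ := localMass u (T + 1) (2 * R) + κ * ((2 * R) ^ n *
    (volume.real (Metric.ball (0 : Space n) 1) * (T + 1))) with hY
  have hYeq : Y = localMass u (T + 1) (2 * R) + v₀ := by
    have : κ * R ^ n = 1 := by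
      rw [hκ, ← Real.rpow_natCast R n, ← Real.rpow_add hR0]; simp
    rw [hY, hv₀, mul_pow]
    linear_combination (2 ^ n * (volume.real (Metric.ball (0 : Space n) 1) * (T + 1))) * this
  have hm0 : 0 ≤ localMass u (T + 1) (2 * R) := by
    refine setIntegral_nonneg_of_ae_restrict ?_
    exact ae_restrict_of_ae_restrict_of_subset
      ((prod_mono_left (subset_univ _)).trans (slab_subset_domain n (T + 1))) h.nonneg
  have hs := h.integrableOn_mul_spatial (f := fun x => η x ^ 2) (hηs.continuous.pow 2)
    (hasCompactSupport_sq hηc) (χ := fun _ => 1) continuous_const (M := 1) (by simp) (T + 1)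
  simp only [one_mul] at hs
  have hs2 : IntegrableOn (fun y : Space n × ℝ => (u y.1 y.2 + κ) * η y.1 ^ 2)
      (slab n (T + 1)) := by
    simp_rw [add_mul]; exact hs.1.add (hs.2.1.const_mul κ)
  have hf := (h.integrableOn_mul_spatial (continuous_fderiv_sq hηs)
    (hasCompactSupport_fderiv_sq hηc) hχc hχa (T + 1)).2.2 hT1
  have hdc : HasCompactSupport fun x => ‖fderiv ℝ η x‖ ^ 2 := by
    simp_rw [sq]; exact ((hηc.fderiv (𝕜 := ℝ)).norm).mul_left
  have hz := h.integrableOn_mul_spatial (((hηs.continuous_fderiv (by simp)).norm).pow 2) hdc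
    hχc hχa (T + 1)
  have hz2 : IntegrableOn (fun y : Space n × ℝ => (u y.1 y.2 + κ) *
      (χ y.2 * ‖fderiv ℝ η y.1‖ ^ 2)) (slab n (T + 1)) := by
    simp_rw [add_mul]; exact hz.1.add (hz.2.1.const_mul κ)
  have hR2 : 0 ≤ 2 * R := by linarith
  have b1 := h.integral_slab_le (κ := κ) (M := 1) hT1.le hR2 hs.1
    (fun y hy => by simp [(hout _ hy).1]) (fun y hy => by
      have := spaceCutoff_sq_le_one (R := R) y.1
      nlinarith [mul_le_of_le_one_right hy this])
  have b2 := h.integral_slab_le (κ := κ) (M := 1) hT1.le hR2 hs2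
    (fun y hy => by simp [(hout _ hy).1]) (fun y hy => by
      rw [one_mul]
      exact mul_le_of_le_one_right (by linarith) (spaceCutoff_sq_le_one (R := R) y.1))
  have b3 := h.integral_slab_le (κ := κ) (M := (P / R) ^ 2) hT1.le hR2 hz2
    (fun y hy => by simp [(hout _ hy).2]) (fun y hy => by
      rw [mul_comm]
      refine mul_le_mul_of_nonneg_right ?_ (by linarith)
      calc χ y.2 * ‖fderiv ℝ η y.1‖ ^ 2 ≤ 1 * (P / R) ^ 2 :=
            mul_le_mul (hχ1 _) (pow_le_pow_left₀ (norm_nonneg _) (hP R hR0 _) 2) (by positivity)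
              zero_le_one
        _ = _ := one_mul _)
  rw [← hY] at b1 b2 b3
  set q := ∫ y in slab n (T + 1), ‖F y‖ * (χ y.2 * ‖fderiv ℝ (fun x => η x ^ 2) y.1‖) with hq
  have hqle : shellFlux F T R ≤ q := by
    have hsub : slab n T ⊆ slab n (T + 1) :=
      prod_mono_right (Ioc_subset_Ioc_right (by linarith))
    have : shellFlux F T R = ∫ y in slab n T,
        ‖F y‖ * (χ y.2 * ‖fderiv ℝ (fun x => η x ^ 2) y.1‖) :=
      setIntegral_congr_fun (measurableSet_slab n T) fun y hy => by
        have : χ y.2 = 1 := Real.smoothTransition.one_of_one_le (by linarith [hy.2.2])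
        simp only [this, one_mul, hη]
    rw [this]
    refine setIntegral_mono_set hf (Eventually.of_forall fun y => ?_)
      (LE.le.eventuallyLE hsub)
    exact mul_nonneg (norm_nonneg _) (mul_nonneg (hχ0 _) (norm_nonneg _))
  have hE : ∫ y in slab n (T + 1), energyDensity α κ K L χ η u F y
      = Γ * L * (∫ y in slab n (T + 1), u y.1 y.2 * η y.1 ^ 2)
        + K * Γ ^ 2 * (∫ y in slab n (T + 1), (u y.1 y.2 + κ) * η y.1 ^ 2) + Γ * q := by
    simp only [energyDensity, hΓ2, ← hΓ]
    have j1 : IntegrableOn (fun y : Space n × ℝ => Γ * L * (u y.1 y.2 * η y.1 ^ 2)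
        + K * Γ ^ 2 * ((u y.1 y.2 + κ) * η y.1 ^ 2)) (slab n (T + 1)) :=
      (hs.1.const_mul _).add (hs2.const_mul _)
    rw [integral_add j1 (hf.const_mul _), integral_add (hs.1.const_mul _) (hs2.const_mul _),
      integral_const_mul, integral_const_mul, integral_const_mul]
  set θ : ℝ := 1 / (2 * R * Γ) with hθ
  have hθ0 : 0 < θ := by positivity
  have main := h.integral_flux_le hα hα' hK hκ0 hT1 hL0 hL hθ0 hηs hηc
    (fun x => spaceCutoff_nonneg x)
  rw [← hχ] at main
  change q ≤ θ * (∫ y in slab n (T + 1), energyDensity α κ K L χ η u F y)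
    + θ⁻¹ * (4 * K / α * ∫ y in slab n (T + 1),
      (u y.1 y.2 + κ) * (χ y.2 * ‖fderiv ℝ η y.1‖ ^ 2)) at main
  rw [hE] at main
  have hq0 : 0 ≤ q := setIntegral_nonneg (measurableSet_slab n (T + 1)) fun y _ =>
    mul_nonneg (norm_nonneg _) (mul_nonneg (hχ0 _) (norm_nonneg _))
  have hY0 : 0 ≤ Y := by rw [hYeq]; linarith
  have m1 : q ≤ θ * (Γ * L * Y + K * Γ ^ 2 * Y + Γ * q)
      + θ⁻¹ * (4 * K / α * ((P / R) ^ 2 * Y)) := by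
    refine main.trans ?_
    rw [one_mul] at b1 b2
    gcongr
  have hΓRR : Γ / R = R ^ (n * α - 1) := by
    rw [hΓR, Real.rpow_sub hR0, Real.rpow_one]
  calc shellFlux F T R ≤ q := hqle
    _ ≤ Γ / R * (C₀ * Y) := le_of_absorption hα hL0 hR hΓ1 hY0 hq0 m1
    _ = C₀ * R ^ (n * α - 1) * Y := by rw [hΓRR]; ring
    _ ≤ C₀ * R ^ (n * α - 1) * ((1 + v₀) * (1 + localMass u (T + 1) (2 * R))) := by
        refine mul_le_mul_of_nonneg_left ?_ (by positivity)
        rw [hYeq]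
        linarith [mul_nonneg hv0 hm0]
    _ = _ := by ring

end ScalarSolution


/-! ### Decay of the flux and conservation of mass. -/

namespace ScalarSolution

variable {n : ℕ} {α K : ℝ} {u0 : Space n → ℝ} {u : Space n → ℝ → ℝ}
  {F Du : Space n × ℝ → Space n}

/-- A crude bound of the flux through a shell, from square integrability. -/
theorem exists_shellFlux_le_pow (h : ScalarSolution α K u0 u F Du) {T : ℝ} (hT : 0 < T) :
    ∃ C : ℝ, 0 ≤ C ∧ ∀ R : ℝ, 1 ≤ R → shellFlux F T R ≤ C * R ^ (n : ℝ) := by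
  obtain ⟨P, hP0, hP⟩ := exists_norm_fderiv_spaceCutoff_le n
  set A := ∫ y in slab n T, ‖F y‖ ^ 2 with hA
  have hA0 : 0 ≤ A := setIntegral_nonneg (measurableSet_slab n T) fun y _ => sq_nonneg _
  set v₀ := 2 ^ n * (volume.real (Metric.ball (0 : Space n) 1) * T) with hv₀
  have hv₀0 : 0 ≤ v₀ := by positivity
  refine ⟨A + (2 * P) ^ 2 * v₀, by positivity, fun R hR => ?_⟩
  have hR0 : 0 < R := by linarith
  have hFi : IntegrableOn (fun y => ‖F y‖ ^ 2) (slab n T) := (h.flux_sq T hT).norm.integrable_sq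
  set B := Metric.closedBall (0 : Space n) (2 * R) ×ˢ Ioc 0 T with hB
  have hsub : B ⊆ slab n T := prod_mono_left (subset_univ _)
  have hout : ∀ x : Space n, x ∉ Metric.closedBall 0 (2 * R) →
      fderiv ℝ (fun x => spaceCutoff n R x ^ 2) x = 0 := fun x hx => by
    have h1 : spaceCutoff n R x = 0 :=
      image_eq_zero_of_notMem_tsupport fun h' => hx (tsupport_spaceCutoff hR0 h')
    have := norm_fderiv_sq (contDiff_spaceCutoff (n := n) (R := R)) x
    rw [h1, abs_zero, mul_zero, zero_mul] at this
    exact norm_eq_zero.1 this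
  have hle : ∀ x : Space n, ‖fderiv ℝ (fun x => spaceCutoff n R x ^ 2) x‖ ≤ 2 * P := fun x => by
    rw [norm_fderiv_sq contDiff_spaceCutoff, abs_of_nonneg (spaceCutoff_nonneg x)]
    have h1 := (hP R hR0 x).trans (div_le_self hP0 hR)
    have h2 := spaceCutoff_le_one (R := R) x
    calc 2 * spaceCutoff n R x * ‖fderiv ℝ (spaceCutoff n R) x‖ ≤ 2 * 1 * P := by
          have := spaceCutoff_nonneg (R := R) x
          gcongr
      _ = _ := by ring
  have i2 : IntegrableOn (fun _ : Space n × ℝ => (2 * P) ^ 2) B :=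
    ((integrableOn_one (isCompact_closedBall (0 : Space n) (2 * R)) T).const_mul _).congr
      (Eventually.of_forall fun _ => mul_one _)
  have i1 := hFi.mono_set hsub
  calc shellFlux F T R
      = ∫ y in B, ‖F y‖ * ‖fderiv ℝ (fun x => spaceCutoff n R x ^ 2) y.1‖ :=
        setIntegral_eq_of_subset_of_forall_sdiff_eq_zero (measurableSet_slab n T) hsub
          fun y hy => by rw [hout y.1 fun h' => hy.2 ⟨h', hy.1.2⟩]; simp
    _ ≤ ∫ y in B, (‖F y‖ ^ 2 + (2 * P) ^ 2) := by
        refine setIntegral_mono ((h.integrableOn_shellFlux hT hR0).mono_set hsub) (i1.add i2)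
          fun y => ?_
        have h1 := mul_le_mul_of_nonneg_left (hle y.1) (norm_nonneg (F y))
        have h2 := sq_nonneg (‖F y‖ - 2 * P)
        have h3 : 0 ≤ ‖F y‖ * (2 * P) := by positivity
        simp only
        linarith
    _ = (∫ y in B, ‖F y‖ ^ 2) + (2 * P) ^ 2 * (v₀ * R ^ n) := by
        rw [integral_add i1 i2, setIntegral_const, hB, volume_real_cylinder n (by linarith) hT.le,
          hv₀, smul_eq_mul]
        ring
    _ ≤ A * R ^ n + (2 * P) ^ 2 * (v₀ * R ^ n) := by
        have h1 : ∫ y in B, ‖F y‖ ^ 2 ≤ A :=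
          setIntegral_mono_set hFi (Eventually.of_forall fun y => sq_nonneg _)
            (LE.le.eventuallyLE hsub)
        have h2 := mul_le_mul_of_nonneg_left (one_le_pow₀ hR : 1 ≤ R ^ n) hA0
        linarith
    _ = _ := by rw [Real.rpow_natCast]; ring

/-- Bootstrapping the growth bound on the flux. -/
theorem exists_shellFlux_le_iterate (h : ScalarSolution α K u0 u F Du) (hα : 0 < α)
    (hα' : α < 1 / 2) (hnα : n * α < 1) (hK : 0 ≤ K) (hu0 : Integrable u0) (j : ℕ) :
    ∀ T : ℝ, 0 < T → ∃ C : ℝ, 0 ≤ C ∧ ∀ R : ℝ, 1 ≤ R →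
      shellFlux F T R ≤ C * (R ^ (n - j * (1 - n * α)) + R ^ (n * α - 1)) := by
  induction j with
  | zero =>
    intro T hT
    obtain ⟨C, hC0, hC⟩ := h.exists_shellFlux_le_pow hT
    refine ⟨C, hC0, fun R hR => (hC R hR).trans (mul_le_mul_of_nonneg_left ?_ hC0)⟩
    have : 0 ≤ R ^ (n * α - 1) := Real.rpow_nonneg (by linarith) _
    simpa using this
  | succ j ih =>
    intro T hT
    obtain ⟨C₁, hC₁0, hC₁⟩ := h.exists_shellFlux_le hα hα' hK hT
    -- Each round uses one more unit of time and doubles the radius, so the induction must carry all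
    -- `T` at once.
    obtain ⟨C₂, hC₂0, hC₂⟩ := ih (T + 1) (by linarith)
    set M := ∫ x, |u0 x| with hM
    have hM0 : 0 ≤ M := integral_nonneg fun x => abs_nonneg _
    set p : ℝ := n - j * (1 - n * α) with hp
    set N := 1 + (T + 1) * (M + C₂) with hN
    have hN0 : 0 ≤ N := by positivity
    refine ⟨C₁ * (N + (T + 1) * C₂ * 2 ^ p), by positivity, fun R hR => ?_⟩
    have hR0 : 0 < R := by linarith
    have h1 := hC₁ R hR
    have h2 := h.localMass_le hu0 (T := T + 1) (R := 2 * R) (by linarith) (by linarith)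
    have h3 := hC₂ (2 * R) (by linarith)
    have h4 : (2 * R) ^ (n * α - 1) ≤ 1 :=
      Real.rpow_le_one_of_one_le_of_nonpos (by linarith) (by linarith)
    rw [Real.mul_rpow (by norm_num) hR0.le (z := p)] at h3
    have h5 : 1 + localMass u (T + 1) (2 * R) ≤ N + (T + 1) * C₂ * 2 ^ p * R ^ p := by
      have h6 : shellFlux F (T + 1) (2 * R) ≤ C₂ * (2 ^ p * R ^ p + 1) :=
        h3.trans (mul_le_mul_of_nonneg_left (by linarith) hC₂0)
      have h7 : localMass u (T + 1) (2 * R) ≤ (T + 1) * (M + C₂ * (2 ^ p * R ^ p + 1)) :=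
        h2.trans (mul_le_mul_of_nonneg_left (by linarith) (by linarith))
      rw [hN]; linarith
    have hpp : (n : ℝ) - ((j + 1 : ℕ) : ℝ) * (1 - n * α) = (n * α - 1) + p := by
      rw [hp]; push_cast; ring
    rw [hpp, Real.rpow_add hR0]
    set X := R ^ (n * α - 1) with hX
    have hX0 : 0 < X := Real.rpow_pos_of_pos hR0 _
    have hRp : 0 < R ^ p := Real.rpow_pos_of_pos hR0 _
    have hA : 0 ≤ (T + 1) * C₂ * 2 ^ p := by positivity
    calc shellFlux F T R ≤ C₁ * X * (1 + localMass u (T + 1) (2 * R)) := h1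
      _ ≤ C₁ * X * (N + (T + 1) * C₂ * 2 ^ p * R ^ p) := by gcongr
      _ = C₁ * (N * X + (T + 1) * C₂ * 2 ^ p * (X * R ^ p)) := by ring
      _ ≤ C₁ * ((N + (T + 1) * C₂ * 2 ^ p) * (X * R ^ p + X)) := by
        refine mul_le_mul_of_nonneg_left ?_ hC₁0
        have := mul_nonneg hN0 (mul_pos hX0 hRp).le
        have := mul_nonneg hA hX0.le
        linarith
      _ = _ := by ring

/-- Once `j (1 - nα) ≥ n + 1`, the first exponent of the iterated bound is at most `-1 ≤ nα - 1`. -/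
theorem exists_shellFlux_le_decay (h : ScalarSolution α K u0 u F Du) (hα : 0 < α)
    (hα' : α < 1 / 2) (hnα : n * α < 1) (hK : 0 ≤ K) (hu0 : Integrable u0) {T : ℝ} (hT : 0 < T) :
    ∃ C : ℝ, 0 ≤ C ∧ ∀ R : ℝ, 1 ≤ R → shellFlux F T R ≤ C * R ^ (n * α - 1) := by
  obtain ⟨j, hj⟩ := exists_nat_ge ((n + 1) / (1 - n * α))
  obtain ⟨C, hC0, hC⟩ := h.exists_shellFlux_le_iterate hα hα' hnα hK hu0 j T hT
  refine ⟨C * 2, by positivity, fun R hR => (hC R hR).trans ?_⟩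
  rw [mul_assoc, two_mul]
  refine mul_le_mul_of_nonneg_left (add_le_add ?_ le_rfl) hC0
  refine Real.rpow_le_rpow_of_exponent_le hR ?_
  rw [div_le_iff₀ (by linarith)] at hj
  have : 0 ≤ n * α := by positivity
  linarith

/-- Every time slice of the solution is nonnegative. -/
theorem nonneg_slice (h : ScalarSolution α K u0 u F Du) {t : ℝ} (ht : 0 < t) :
    ∀ᵐ x, 0 ≤ u x t := by
  -- almost every slice is nonnegative
  have hae : ∀ᵐ s : ℝ, 0 < s → ∀ᵐ x, 0 ≤ u x s := by
    have h1 := h.nonneg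
    rw [ae_restrict_iff' (isOpen_domain n).measurableSet, Measure.volume_eq_prod] at h1
    have h2 := (Measure.measurePreserving_swap (μ := (volume : Measure ℝ))
      (ν := (volume : Measure (Space n)))).quasiMeasurePreserving.ae h1
    filter_upwards [Measure.ae_ae_of_ae_prod h2] with s hs hs0
    filter_upwards [hs] with x hx using hx ⟨mem_univ _, hs0⟩
  have hdense := Measure.dense_of_ae hae
  have key : ∀ ζ : Space n → ℝ, ContDiff ℝ ∞ ζ → HasCompactSupport ζ → (∀ x, 0 ≤ ζ x) →
      0 ≤ ∫ x, u x t * ζ x := by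
    intro ζ hζ hζc hζ0
    -- The sign is known only for almost every time. Since `∫ u ζ` is right continuous in time,
    -- being a constant minus an integral of the flux over the slab, it passes to `t` along good
    -- times decreasing to `t`.
    obtain ⟨s, hsa, hs, hst⟩ := hdense.exists_seq_strictAnti_tendsto t
    have hpos : ∀ j, 0 < s j := fun j => ht.trans (hs j).1
    have hi : IntegrableOn (fun y => fderiv ℝ ζ y.1 (F y)) (slab n (s 0)) := by
      have h1 := (h.integrableOn_mul_spatial ((hζ.continuous_fderiv (by simp)).norm)
        ((hζc.fderiv (𝕜 := ℝ)).norm) (χ := fun _ => 1) continuous_const (M := 1) (by simp)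
        (s 0)).2.2 (hpos 0)
      refine h1.mono' ?_ (Eventually.of_forall fun y => ?_)
      · exact isBoundedBilinearMap_apply.continuous.comp_aestronglyMeasurable
          ((((hζ.continuous_fderiv (by simp)).comp continuous_fst).aestronglyMeasurable).prodMk
            (h.flux_sq _ (hpos 0)).1)
      · simp only [one_mul]
        rw [mul_comm]
        exact (fderiv ℝ ζ y.1).le_opNorm _
    have hInter : ⋂ j, slab n (s j) = slab n t := by
      ext y
      simp only [mem_iInter, slab, mem_prod, mem_univ, true_and, mem_Ioc]
      exact ⟨fun hy => ⟨(hy 0).1, ge_of_tendsto' hst fun j => (hy j).2⟩,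
        fun hy j => ⟨hy.1, hy.2.trans (le_of_lt (hs j).1)⟩⟩
    have hlim := tendsto_setIntegral_of_antitone (μ := volume) (s := fun j => slab n (s j))
      (f := fun y => fderiv ℝ ζ y.1 (F y)) (fun j => measurableSet_slab n (s j))
      (fun i j hij => prod_mono_right (Ioc_subset_Ioc_right (hsa.antitone hij))) ⟨0, hi⟩
    rw [hInter] at hlim
    have e : ∀ r, 0 < r → ∫ x, u x r * ζ x
        = (∫ x, u0 x * ζ x) - ∫ y in slab n r, fderiv ℝ ζ y.1 (F y) := fun r hr => by
      linarith [h.integral_slice_sub hζ hζc hr]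
    rw [e t ht]
    refine ge_of_tendsto' (tendsto_const_nhds.sub hlim) fun j => ?_
    rw [← e _ (hpos j)]
    refine integral_nonneg_of_ae ?_
    filter_upwards [(hs j).2 (hpos j)] with x hx using mul_nonneg hx (hζ0 x)
  let ρ : ℕ → ContDiffBump (0 : Space n) := fun j =>
    ⟨1 / ((j : ℝ) + 1) / 2, 1 / ((j : ℝ) + 1), by positivity, half_lt_self (by positivity)⟩
  have hρ0 : Tendsto (fun j => (ρ j).rOut) atTop (𝓝 0) := tendsto_one_div_add_atTop_nhds_zero_nat
  have hρ2 : ∀ j, (ρ j).rOut ≤ 2 * (ρ j).rIn := fun j => by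
    change 1 / ((j : ℝ) + 1) ≤ 2 * (1 / ((j : ℝ) + 1) / 2); linarith
  -- Using mollification kernels as `ζ` gives the pointwise sign at Lebesgue points.
  filter_upwards [ae_tendsto_mollify hρ0 hρ2 (h.locallyIntegrable_slice t ht)] with x hx
  refine ge_of_tendsto' hx fun j => ?_
  rw [mollify_apply]
  simp_rw [mul_comm _ (u _ t)]
  refine key _ ((ρ j).contDiff_normed.comp (contDiff_const.sub contDiff_id)) ?_
    fun z => (ρ j).nonneg_normed _
  exact ((ρ j).hasCompactSupport_normed (μ := volume)).comp_homeomorph (Homeomorph.subLeft x)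

/-- Conservation of mass. -/
theorem mass_eq (h : ScalarSolution α K u0 u F Du) (hα : 0 < α)
    (hα' : α < 1 / 2) (hnα : n * α < 1) (hK : 0 ≤ K) (hu0 : Integrable u0) {t : ℝ} (ht : 0 < t) :
    Integrable (fun x => u x t) ∧ ∫ x, u x t = ∫ x, u0 x := by
  obtain ⟨C, hC0, hC⟩ := h.exists_shellFlux_le_decay hα hα' hnα hK hu0 ht
  set R : ℕ → ℝ := fun j => (j : ℝ) + 1 with hRdef
  have hR1 : ∀ j, 1 ≤ R j := fun j => le_add_of_nonneg_left (Nat.cast_nonneg j)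
  have hR0 : ∀ j, 0 < R j := fun j => one_pos.trans_le (hR1 j)
  have hRt : Tendsto R atTop atTop := tendsto_atTop_add_const_right _ _ tendsto_natCast_atTop_atTop
  set w : ℕ → Space n → ℝ := fun j x => spaceCutoff n (R j) x ^ 2 with hw
  have hw1 : ∀ x, ∀ᶠ j in atTop, w j x = 1 := fun x => by
    filter_upwards [hRt.eventually_ge_atTop ‖x‖] with j hj
    simp only [hw]
    rw [spaceCutoff_eq_one (hR0 j) hj, one_pow]
  have hw0 : ∀ j x, 0 ≤ w j x := fun j x => sq_nonneg _
  have hwle : ∀ j x, w j x ≤ 1 := fun j x => spaceCutoff_sq_le_one x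
  have hwc : ∀ j, Continuous (w j) := fun j => contDiff_spaceCutoff.continuous.pow 2
  have hloc := h.locallyIntegrable_slice t ht
  have hi : ∀ j, Integrable fun x => u x t * w j x := fun j => by
    have := hloc.integrable_smul_right_of_hasCompactSupport (hwc j)
      (hasCompactSupport_sq (hasCompactSupport_spaceCutoff (hR0 j)))
    simpa only [smul_eq_mul] using this
  have hn := h.nonneg_slice ht
  have hdiff : ∀ j, |(∫ x, u x t * w j x) - ∫ x, u0 x * w j x| ≤ C * R j ^ (n * α - 1) := fun j =>
    (h.abs_integral_slice_sub_le ht le_rfl (hR0 j)).trans (hC _ (hR1 j))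
  have hint : Integrable fun x => u x t := by
    refine ⟨hloc.aestronglyMeasurable, ?_⟩
    rw [hasFiniteIntegral_iff_ofReal hn]
    have hb : ∀ j, ∫⁻ x, ENNReal.ofReal (u x t * w j x)
        ≤ ENNReal.ofReal ((∫ x, |u0 x|) + C) := fun j => by
      rw [← ofReal_integral_eq_lintegral_ofReal (hi j)
        (by filter_upwards [hn] with x hx using mul_nonneg hx (hw0 j x))]
      refine ENNReal.ofReal_le_ofReal ((h.integral_slice_le hu0 ht le_rfl (hR0 j)).trans ?_)
      have h1 : R j ^ (n * α - 1) ≤ 1 :=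
        Real.rpow_le_one_of_one_le_of_nonpos (hR1 j) (by linarith)
      have h2 := (hC _ (hR1 j)).trans (mul_le_of_le_one_right hC0 h1)
      linarith
    -- Fatou's lemma along the cutoffs: the masses in balls are bounded because the shell flux is
    -- bounded in `R`.
    have hF : ∫⁻ x, ENNReal.ofReal (u x t)
        ≤ liminf (fun j => ∫⁻ x, ENNReal.ofReal (u x t * w j x)) atTop := by
      refine le_trans (lintegral_mono fun x => ?_) (lintegral_liminf_le'
        fun j => (hi j).aestronglyMeasurable.aemeasurable.ennreal_ofReal)
      have : Tendsto (fun j => ENNReal.ofReal (u x t * w j x)) atTop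
          (𝓝 (ENNReal.ofReal (u x t))) := by
        refine tendsto_const_nhds.congr' ?_
        filter_upwards [hw1 x] with j hj
        rw [hj, mul_one]
      rw [this.liminf_eq]
    have hL : liminf (fun j => ∫⁻ x, ENNReal.ofReal (u x t * w j x)) atTop
        ≤ ENNReal.ofReal ((∫ x, |u0 x|) + C) := liminf_le_of_le (by isBoundedDefault) fun b hb' => by
      obtain ⟨j, hj⟩ := Eventually.exists hb'
      exact le_trans hj (hb j)
    exact (hF.trans hL).trans_lt ENNReal.ofReal_lt_top
  refine ⟨hint, ?_⟩
  have hT : ∀ f : Space n → ℝ, Integrable f →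
      Tendsto (fun j => ∫ x, f x * w j x) atTop (𝓝 (∫ x, f x)) := fun f hf => by
    refine tendsto_integral_of_dominated_convergence (fun x => |f x|)
      (fun j => hf.aestronglyMeasurable.mul (hwc j).aestronglyMeasurable) hf.abs
      (fun j => Eventually.of_forall fun x => ?_) (Eventually.of_forall fun x => ?_)
    · rw [norm_mul, Real.norm_eq_abs, Real.norm_of_nonneg (hw0 j x)]
      exact mul_le_of_le_one_right (abs_nonneg _) (hwle j x)
    · refine tendsto_const_nhds.congr' ?_
      filter_upwards [hw1 x] with j hj
      rw [hj, mul_one]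
  have hz : Tendsto (fun j => (∫ x, u x t * w j x) - ∫ x, u0 x * w j x) atTop (𝓝 0) := by
    refine squeeze_zero_norm hdiff ?_
    have h1 : Tendsto (fun j => R j ^ (-(1 - n * α))) atTop (𝓝 0) :=
      (tendsto_rpow_neg_atTop (by linarith)).comp hRt
    simpa using h1.const_mul C
  have := tendsto_nhds_unique ((hT _ hint).sub (hT _ hu0)) hz
  linarith

end ScalarSolution


/-! ### From the system to the scalar equation, and the ranges of `m`. -/

/-- The structure conditions bound the square of the flux by the dissipation. -/
theorem sq_norm_flux_le {n : ℕ} {m c C2 C3 C4 D z : ℝ} (hm : 0 < m) (hc : 0 < c)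
    (hD : 0 ≤ D) {a p : Space n}
    (hco : c * ‖p‖ ^ 2 - C2 * z ^ 2 ≤ inner ℝ a p) (hgr : ‖a‖ ≤ C3 * ‖p‖ + C4 * z) :
    -(m * C2) * (D * z ^ 2) ≤ inner ℝ ((m * D) • a) p ∧
    ‖(m * D) • a‖ ^ 2 ≤ (2 * m * C3 ^ 2 / c + 1) * D *
      (inner ℝ ((m * D) • a) p + (m * C2 + 2 * m ^ 2 * C4 ^ 2) * (D * z ^ 2)) := by
  have hmD : 0 ≤ m * D := mul_nonneg hm.le hD
  have h1 : c * ‖p‖ ^ 2 ≤ inner ℝ a p + C2 * z ^ 2 := by linarith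
  have h0 : 0 ≤ inner ℝ a p + C2 * z ^ 2 := le_trans (by positivity) h1
  have h2 : ‖a‖ ^ 2 ≤ 2 * C3 ^ 2 * ‖p‖ ^ 2 + 2 * C4 ^ 2 * z ^ 2 := by
    have := pow_le_pow_left₀ (norm_nonneg a) hgr 2
    linarith [sq_nonneg (C3 * ‖p‖ - C4 * z)]
  have h3 : 2 * C3 ^ 2 * ‖p‖ ^ 2 ≤ 2 * C3 ^ 2 / c * (inner ℝ a p + C2 * z ^ 2) := by
    calc 2 * C3 ^ 2 * ‖p‖ ^ 2 = 2 * C3 ^ 2 / c * (c * ‖p‖ ^ 2) := by field_simp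
      _ ≤ _ := mul_le_mul_of_nonneg_left h1 (by positivity)
  rw [real_inner_smul_left, norm_smul, mul_pow, Real.norm_of_nonneg hmD]
  constructor
  · have := mul_nonneg hmD h0
    linarith
  · have h4 : (m * D) ^ 2 * ‖a‖ ^ 2 ≤ (m * D) ^ 2 *
        (2 * C3 ^ 2 / c * (inner ℝ a p + C2 * z ^ 2) + 2 * C4 ^ 2 * z ^ 2) :=
      mul_le_mul_of_nonneg_left (h2.trans (by linarith)) (sq_nonneg _)
    have h5 : 0 ≤ D * (m * D) * (inner ℝ a p + C2 * z ^ 2) := by positivity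
    have h6 : 0 ≤ 2 * m * C3 ^ 2 / c * (2 * m ^ 2 * C4 ^ 2 * D ^ 2 * z ^ 2) := by positivity
    refine h4.trans ?_
    -- The summand `1` in the coefficient makes room for the term `2 m² C4² D² z²` from the growth
    -- of `𝒜`; the coercivity part needs only `2 m C3² / c`.
    have e : (2 * m * C3 ^ 2 / c + 1) * D *
        (m * D * inner ℝ a p + (m * C2 + 2 * m ^ 2 * C4 ^ 2) * (D * z ^ 2))
        = (m * D) ^ 2 * (2 * C3 ^ 2 / c * (inner ℝ a p + C2 * z ^ 2) + 2 * C4 ^ 2 * z ^ 2)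
          + D * (m * D) * (inner ℝ a p + C2 * z ^ 2)
          + 2 * m * C3 ^ 2 / c * (2 * m ^ 2 * C4 ^ 2 * D ^ 2 * z ^ 2) := by ring
    rw [e]
    linarith

/-- The exponent `m - 1` is negative, so the lower bound on `w` becomes an upper bound for
`w^(m-1)`. At `z = 0` the positive exponent of `z` makes the product zero. -/
theorem rpow_mul_rpow_le {lam b m z w : ℝ} (hlam : 0 < lam) (hb : 0 < b) (hm : m < 1) (hz : 0 ≤ z)
    (h : lam * z ^ b ≤ w) : w ^ (m - 1) * z ^ (b * (1 - m)) ≤ lam ^ (m - 1) := by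
  have hα : 0 < b * (1 - m) := mul_pos hb (by linarith)
  rcases hz.eq_or_lt with rfl | hz
  · rw [Real.zero_rpow hα.ne', mul_zero]; positivity
  · calc w ^ (m - 1) * z ^ (b * (1 - m)) ≤ (lam * z ^ b) ^ (m - 1) * z ^ (b * (1 - m)) := by
          refine mul_le_mul_of_nonneg_right ?_ (by positivity)
          exact Real.rpow_le_rpow_of_nonpos (by positivity) h (by linarith)
      _ = lam ^ (m - 1) := by
          rw [Real.mul_rpow hlam.le (by positivity), ← Real.rpow_mul hz.le, mul_assoc,
            ← Real.rpow_add hz, show b * (m - 1) + b * (1 - m) = 0 by ring, Real.rpow_zero,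
            mul_one]

/-- Each component of a solution of the system solves a scalar equation with controlled flux. -/
theorem scalarSolution_component {n k : ℕ} {m : ℝ} (hm0 : 0 < m) (hm1 : m < 1)
    {lam β : Fin k → ℝ} (hlam : ∀ i, 0 < lam i) {c C2 C3 C4 q : ℝ} (hc : 0 < c) (hC2 : 0 ≤ C2)
    {U : (Fin k → ℝ) → ℝ}
    {A : Space n → ℝ → Space n → ℝ → Space n} {B : ℝ → Space n → ℝ → Space n}
    {u0 : Fin k → Space n → ℝ}
    {u : Fin k → Space n → ℝ → ℝ} {Du : Fin k → Space n × ℝ → Space n}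
    (hfield : FieldCondition A B c C2 C3 C4 0 q)
    (hsc : SolutionCondition m lam β c C2 U A B u Du)
    (hu : IsWeakSolution m U A B u0 u Du) (i : Fin k) (hi : 0 < β i)
    (hα : β i * (1 - m) < 2) :
    ScalarSolution (β i * (1 - m))
      (((2 * m * C3 ^ 2 / c + 1) + (m * C2 + 2 * m ^ 2 * C4 ^ 2)) * lam i ^ (m - 1))
      (u0 i) (u i) (flux m U A B u Du i) (Du i) := by
  have hflux : ∀ᵐ y ∂(volume.restrict (domain n)), flux m U A B u Du i y
      = (m * U (vec u y) ^ (m - 1)) • fieldA A u Du i y := by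
    filter_upwards [hsc.lower, hfield.growth_B] with y h1 h2
    have h3 := h2 (u i y.1 y.2) (h1 i).1
    rw [zero_mul] at h3
    have h4 : fieldB B u i y = 0 := norm_le_zero_iff.1 h3
    rw [flux, h4, add_zero]
  refine ⟨hu.locallyIntegrable i, hu.locallyIntegrable_slice i,
    hsc.lower.mono fun y hy => (hy i).1, hu.weakGradient i, hu.gradient_sq i, fun T hT => ?_,
    hu.weak_form i, ?_⟩
  · refine ((hu.energy i T hT).const_smul m).ae_eq ?_
    filter_upwards [ae_slab_of_ae_domain hflux] with y hy
    rw [hy, Pi.smul_apply, smul_smul]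
  · filter_upwards [hflux, hsc.lower, hfield.coercive, hfield.growth_A] with y hF hlow hco hgr
    obtain ⟨hz, hlz⟩ := hlow i
    have hw0 : 0 ≤ U (vec u y) :=
      (mul_nonneg (hlam i).le (Real.rpow_nonneg hz _)).trans hlz
    have hD : 0 ≤ U (vec u y) ^ (m - 1) := Real.rpow_nonneg hw0 _
    obtain ⟨hl, hs⟩ := sq_norm_flux_le (C3 := C3) (C4 := C4) hm0 hc hD
      (hco (Du i y) _ hz) (hgr (Du i y) _ hz)
    have hDz := rpow_mul_rpow_le (hlam i) hi hm1 hz hlz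
    set D := U (vec u y) ^ (m - 1) with hDdef
    set z := u i y.1 y.2 with hzdef
    set α := β i * (1 - m) with hαdef
    set P := 2 * m * C3 ^ 2 / c + 1 with hP
    set N := m * C2 + 2 * m ^ 2 * C4 ^ 2 with hN
    set Λ := lam i ^ (m - 1) with hΛ
    have hP0 : 0 ≤ P := by positivity
    have hN0 : 0 ≤ N := by positivity
    have hΛ0 : 0 ≤ Λ := Real.rpow_nonneg (hlam i).le _
    have hα0 : 0 < α := mul_pos hi (by linarith)
    have hz2 : z ^ 2 = z ^ α * z ^ (2 - α) := by
      rw [← Real.rpow_add_of_nonneg hz hα0.le (by linarith), add_sub_cancel]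
      norm_num
    have hr : 0 ≤ z ^ (2 - α) := Real.rpow_nonneg hz _
    have hDz2 : D * z ^ 2 ≤ Λ * z ^ (2 - α) := by
      rw [hz2, ← mul_assoc]
      exact mul_le_mul_of_nonneg_right hDz hr
    have hlow1 : N * (D * z ^ 2) ≤ (P + N) * Λ * z ^ (2 - α) := by
      calc N * (D * z ^ 2) ≤ N * (Λ * z ^ (2 - α)) := mul_le_mul_of_nonneg_left hDz2 hN0
        _ ≤ N * (Λ * z ^ (2 - α)) + P * (Λ * z ^ (2 - α)) :=
          le_add_of_nonneg_right (by positivity)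
        _ = _ := by ring
    have hlow2 : m * C2 * (D * z ^ 2) ≤ N * (D * z ^ 2) :=
      mul_le_mul_of_nonneg_right (le_add_of_nonneg_right (by positivity)) (by positivity)
    rw [hF]
    change -(m * C2) * (D * z ^ 2) ≤ inner ℝ ((m * D) • fieldA A u Du i y) (Du i y) at hl
    change ‖(m * D) • fieldA A u Du i y‖ ^ 2 ≤ P * D *
      (inner ℝ ((m * D) • fieldA A u Du i y) (Du i y) + N * (D * z ^ 2)) at hs
    -- The constant `(P + N) * Λ` serves twice: `P * Λ` bounds the coefficient and `N * Λ` bounds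
    -- the lower order term.
    refine ⟨P * D, mul_nonneg hP0 hD, ?_, by linarith, ?_⟩
    · calc P * D * z ^ α = P * (D * z ^ α) := by ring
        _ ≤ P * Λ := mul_le_mul_of_nonneg_left hDz hP0
        _ ≤ (P + N) * Λ := by linarith [mul_nonneg hN0 hΛ0]
    · exact hs.trans (mul_le_mul_of_nonneg_left (by linarith) (mul_nonneg hP0 hD))

/-- This crude bound suffices: it leaves `n (4 (n + 1) - 3 n) = n² + 4 n`, below the denominator `n²
+ 5 n + 8`. -/
theorem three_mul_le_sqrt {n : ℝ} (hn : 0 ≤ n) : 3 * n ≤ √(2 * n * (7 * n + 11)) := by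
  refine Real.le_sqrt_of_sq_le ?_
  nlinarith [sq_nonneg n]

/-- It leaves `n ((3 n + 1) - (2 n - 1)) = n² + 2 n`, below the denominator `n² + 2 n + 4`. -/
theorem two_mul_sub_one_le_sqrt {n : ℝ} (hn : 2 ≤ n) : 2 * n - 1 ≤ √(7 * n ^ 2 + 2 * n - 7) := by
  refine Real.le_sqrt_of_sq_le ?_
  nlinarith

/-- Below a threshold of the form `1 - (p - r) / (b d)` the exponent is small. -/
theorem mul_one_sub_lt_of_lt {n b d p r m : ℝ} (hb : 0 < b) (hd : 0 < d) (hn : 0 < n)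
    (h : 1 - p / (b * d) + r / (b * d) < m) (hpr : n * (p - r) < d) : n * (b * (1 - m)) < 1 := by
  have h1 : 1 - m < (p - r) / (b * d) := by
    rw [sub_div]; linarith
  have h2 : b * (1 - m) * d < p - r := by
    rw [lt_div_iff₀ (mul_pos hb hd)] at h1
    linarith
  have h3 : n * (b * (1 - m)) * d < 1 * d := by
    have := mul_lt_mul_of_pos_left h2 hn
    linarith
  exact lt_of_mul_lt_mul_right h3 hd.le

end GPS

theorem corollary1p5 (n k : ℕ) (hn : 2 ≤ n) (m : ℝ) (hm : m ∈ Set.Ioo (1 - 2 / (n : ℝ)) 1)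
    (lam β : Fin k → ℝ) (hlam : ∀ i, 0 < lam i) (hβ : ∀ i, 0 ≤ β i)
    (c C1 C2 C3 C4 C5 q : ℝ) (hc : 0 < c)
    (hC1 : 0 ≤ C1) (hC2 : 0 ≤ C2) (hC3 : 0 ≤ C3) (hC4 : 0 ≤ C4) (hC5 : C5 = 0)
    (U : (Fin k → ℝ) → ℝ)
    (A : GPS.Space n → ℝ → GPS.Space n → ℝ → GPS.Space n)
    (B : ℝ → GPS.Space n → ℝ → GPS.Space n)
    (u0 : Fin k → GPS.Space n → ℝ)
    (u : Fin k → GPS.Space n → ℝ → ℝ) (Du : Fin k → GPS.Space n × ℝ → GPS.Space n)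
    (hAB : GPS.Caratheodory A B)
    (hU : GPS.CoefficientCondition U C1)
    (hfield : GPS.FieldCondition A B c C2 C3 C4 C5 q)
    (hsc : GPS.SolutionCondition m lam β c C2 U A B u Du)
    (hu0 : ∀ i, (∀ x, 0 ≤ u0 i x) ∧ MeasureTheory.Integrable (u0 i) ∧ HasCompactSupport (u0 i))
    (hu : GPS.IsWeakSolution m U A B u0 u Du)
    (i : Fin k) (hi : 0 < β i) :
    (m ∈ Set.Ioo
        (1 - 4 * ((n : ℝ) + 1) / (β i * ((n : ℝ) ^ 2 + 5 * n + 8))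
          + √(2 * n * (7 * n + 11)) / (β i * ((n : ℝ) ^ 2 + 5 * n + 8))) 1 →
      ∀ t : ℝ, 0 < t →
        MeasureTheory.Integrable (fun x => u i x t) ∧ ∫ x, u i x t = ∫ x, u0 i x) ∧
    (C2 = 0 → C4 = 0 →
      m ∈ Set.Ioo
        (1 - (3 * (n : ℝ) + 1) / (β i * ((n : ℝ) ^ 2 + 2 * n + 4))
          + √(7 * (n : ℝ) ^ 2 + 2 * n - 7) / (β i * ((n : ℝ) ^ 2 + 2 * n + 4))) 1 →
      ∀ t : ℝ, 0 < t →
        MeasureTheory.Integrable (fun x => u i x t) ∧ ∫ x, u i x t = ∫ x, u0 i x) := by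
  have hn2 : (2 : ℝ) ≤ n := by exact_mod_cast hn
  have hn0 : (0 : ℝ) < n := by linarith
  have hm0 : 0 < m := by
    have : 2 / (n : ℝ) ≤ 1 := (div_le_one hn0).2 hn2
    linarith [hm.1]
  have hα0 : 0 < β i * (1 - m) := mul_pos hi (by linarith [hm.2])
  subst hC5
  -- The criterion common to both ranges. As `n ≥ 2`, it contains the condition `α < 1 / 2` of the
  -- energy estimates.
  have main : (n : ℝ) * (β i * (1 - m)) < 1 → ∀ t : ℝ, 0 < t →
      MeasureTheory.Integrable (fun x => u i x t) ∧ ∫ x, u i x t = ∫ x, u0 i x := by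
    intro hα t ht
    have hα' : β i * (1 - m) < 1 / 2 := by
      have := mul_le_mul_of_nonneg_right hn2 hα0.le
      linarith
    have hlam' := Real.rpow_nonneg (hlam i).le (m - 1)
    exact (GPS.scalarSolution_component hm0 hm.2 hlam hc hC2 hfield hsc hu i hi
      (by linarith)).mass_eq hα0 hα' hα (by positivity) (hu0 i).2.1 ht
  refine ⟨fun h => main ?_, fun _ _ h => main ?_⟩
  · refine GPS.mul_one_sub_lt_of_lt hi (by positivity) hn0 h.1 ?_
    have := mul_le_mul_of_nonneg_left (GPS.three_mul_le_sqrt hn0.le) hn0.le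
    linarith
  · refine GPS.mul_one_sub_lt_of_lt hi (by positivity) hn0 h.1 ?_
    have := mul_le_mul_of_nonneg_left (GPS.two_mul_sub_one_le_sqrt hn2) hn0.le
    linarith
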